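/- Let $V \neq \{0\}$ be a complex Hausdorff locally convex space whose topology is given by its continuous Hilbert seminorms, i.e. every continuous seminorm on $V$ is dominated by a seminorm $\|v\|_\alpha = \sqrt{\langle v, v\rangle_\alpha}$, where $\langle\cdot,\cdot\rangle_\alpha$ is a continuous positive (semi-definite) Hermitian form on $V$, antilinear in the first argument. Let $\overline{\,\cdot\,} : V \to V$ be a continuous antilinear involution, and call a bilinear form $\Lambda$ on $V$ Hermitian if $\Lambda(v,w) = \overline{\Lambda(\overline{w},\overline{v})}$ for all $v, w \in V$. Let $\mathcal{T}^\bullet(V) = \bigoplus_{k \ge 0} V^{\otimes k}$ be the algebraic tensor algebra with the locally convex topology defined by the seminorms $\|X\|^\bullet_\alpha = \sqrt{\langle X, X\rangle^\bullet_\alpha}$, one for every continuous positive Hermitian form $\langle\cdot,\cdot\rangle_\alpha$ on $V$. Here $\langle\cdot,\cdot\rangle^\bullet_\alpha$ is the sesquilinear form for which tensors of different degrees are orthogonal and $$\langle x_1 \otimes \cdots \otimes x_k,\, y_1 \otimes \cdots \otimes y_k\rangle^\bullet_\alpha = k! \prod_{m=1}^k \langle x_m, y_m\rangle_\alpha .$$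 Let $\mathcal{S}^\bullet(V) \subseteq \mathcal{T}^\bullet(V)$ be the subspace of symmetric tensors with the subspace topology, i.e. the image of the linear symmetrisation operator $\mathscr{S}(x_1\otimes\cdots\otimes x_k) = \frac{1}{k!}\sum_{\sigma \in \mathfrak{S}_k} x_{\sigma(1)}\otimes\cdots\otimes x_{\sigma(k)}$. Let ${}^*$ be the antilinear map with $(x_1\otimes\cdots\otimes x_k)^* = \overline{x_k}\otimes\cdots\otimes\overline{x_1}$, restricted to $\mathcal{S}^\bullet(V)$. For a continuous bilinear form $\Lambda$ on $V$ define the star product on $\mathcal{S}^\bullet(V)$ by $$X \star_\Lambda Y = \sum_{t=0}^\infty \frac{1}{t!}\, \mu_\vee\big((P_\Lambda)^t (X \otimes Y)\big),$$ a sum with only finitely many non-zero terms, where $\mu_\vee(X\otimes Y) = \mathscr{S}(XY)$ with $XY$ the product in the tensor algebra, and $P_\Lambda$ is the linear operator on $\mathcal{T}^\bullet(V)\otimes\mathcal{T}^\bullet(V)$ given by $$P_\Lambda\big((x_1\otimes\cdots\otimes x_k)\otimes(y_1\otimes\cdots\otimes y_\ell)\big) = k\ell\,\Lambda(x_k,y_1)\,(x_1\otimes\cdots\otimes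 x_{k-1})\otimes(y_2\otimes\cdots\otimes y_\ell)$$ for $k, \ell \ge 1$, and by $0$ if $k = 0$ or $\ell = 0$. A linear functional $\omega$ on $\mathcal{S}^\bullet(V)$ is positive for $\star_\Lambda$ if $\omega(X^* \star_\Lambda X) \ge 0$ for all $X \in \mathcal{S}^\bullet(V)$. A bilinear form $b : V\times V\to\mathbb{C}$ is of Hilbert–Schmidt type if there is a continuous positive Hermitian form $\langle\cdot,\cdot\rangle_\alpha$ on $V$ such that $b(v,w) = 0$ whenever $\|v\|_\alpha = 0$ or $\|w\|_\alpha = 0$, and such that $\sum_{i,j=1}^d |b(e_i,e_j)|^2 \le 1$ for every finite tuple $(e_1,\dots,e_d)$ of vectors in $V$ that is orthonormal with respect to $\langle\cdot,\cdot\rangle_\alpha$. **Theorem.** Let $\Lambda$ be a continuous Hermitian bilinear form on $V$. There exists a non-zero continuous linear functional on $\mathcal{S}^\bullet(V)$ that is positive for $\star_\Lambda$ if and only if there exists a symmetric and Hermitian bilinear form $b$ of Hilbert–Schmidt type on $V$ such that $\Lambda(\overline{v},v) + b(\overline{v},v) \ge 0$ for all $v\in V$. In this case the continuous linear functionals on $\mathcal{S}^\bullet(V)$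 that are positive for $\star_\Lambda$ are point-separating, i.e. their common kernel is $\{0\}$. -/

import Mathlib

open scoped TensorProduct DirectSum ComplexOrder ComplexConjugate

namespace HilbertStar

noncomputable section

/-! ## Continuous positive Hermitian forms -/

/-- A continuous positive Hermitian form on `V`: sesquilinear (antilinear in the first argument),
Hermitian, positive semi-definite and (jointly) continuous.  The type of all of them plays the role
of the set `I_V`; through `PosHermForm.seminorm` it also indexes the set `P_V` of all continuous
Hilbert seminorms. -/
structure PosHermForm (V : Type*) [AddCommGroup V] [Module ℂ V] [TopologicalSpace V] where
  form : V →ₗ⋆[ℂ] V →ₗ[ℂ] ℂ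
  conj_symm : ∀ v w, conj (form v w) = form w v
  nonneg : ∀ v, 0 ≤ form v v
  cont : Continuous fun p : V × V => form p.1 p.2

instance posHermForm_nonempty {V : Type*} [AddCommGroup V] [Module ℂ V] [TopologicalSpace V] :
    Nonempty (PosHermForm V) :=
  ⟨⟨0, by simp, by simp, by simpa using continuous_const⟩⟩

/-- The Hilbert seminorm `‖v‖ = √⟨v, v⟩` of a semi-definite sesquilinear form. -/
def formSeminorm {E : Type*} [AddCommGroup E] [Module ℂ E] (B : E →ₗ⋆[ℂ] E →ₗ[ℂ] ℂ)
    (hsymm : ∀ v w, conj (B v w) = B w v) (hpos : ∀ v, 0 ≤ B v v) : Seminorm ℂ E :=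
  letI core : PreInnerProductSpace.Core ℂ E :=
    { inner := fun v w => B v w
      conj_inner_symm := fun v w => hsymm w v
      re_inner_nonneg := fun v => (Complex.nonneg_iff.mp (hpos v)).1
      add_left := fun x y z => by simp
      smul_left := fun x y r => by simp }
  letI : SeminormedAddCommGroup E := InnerProductSpace.Core.toSeminormedAddCommGroup (𝕜 := ℂ)
  Seminorm.of (fun v => √((B v v).re))
    (fun x y => norm_add_le x y)
    (fun a x => by
      have h : (starRingEnd ℂ) a * (a * B x x) = ((‖a‖ ^ 2 : ℝ) : ℂ) * B x x := by
        rw [← mul_assoc, mul_comm _ a, Complex.mul_conj, Complex.normSq_eq_norm_sq]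
      have h' : B (a • x) (a • x) = (starRingEnd ℂ) a * (a * B x x) := by
        simp [mul_left_comm]
      rw [h', h, Complex.re_ofReal_mul, Real.sqrt_mul (sq_nonneg ‖a‖),
        Real.sqrt_sq (norm_nonneg a)])

theorem formSeminorm_apply {E : Type*} [AddCommGroup E] [Module ℂ E] (B : E →ₗ⋆[ℂ] E →ₗ[ℂ] ℂ)
    (hsymm : ∀ v w, conj (B v w) = B w v) (hpos : ∀ v, 0 ≤ B v v) (v : E) :
    formSeminorm B hsymm hpos v = √((B v v).re) := rfl

/-- The continuous Hilbert seminorm belonging to a continuous positive Hermitian form. -/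
def PosHermForm.seminorm {V : Type*} [AddCommGroup V] [Module ℂ V] [TopologicalSpace V]
    (α : PosHermForm V) : Seminorm ℂ V :=
  formSeminorm α.form α.conj_symm α.nonneg

/-- The topology of the locally convex space `V` is given by its continuous Hilbert seminorms: these
are cofinal among all continuous seminorms. -/
def IsHilbertisable (V : Type*) [AddCommGroup V] [Module ℂ V] [TopologicalSpace V] : Prop :=
  ∀ p : Seminorm ℂ V, Continuous p → ∃ α : PosHermForm V, p ≤ α.seminorm

/-! ## Bilinear forms -/

section Forms

variable {V : Type*} [AddCommGroup V] [Module ℂ V] [TopologicalSpace V]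

/-- `Λ` equals its conjugate `Λ^*(v, w) = conj (Λ (w̄, v̄))`. -/
def IsHermitian (c : V →L⋆[ℂ] V) (Λ : V →ₗ[ℂ] V →ₗ[ℂ] ℂ) : Prop :=
  ∀ v w, Λ v w = conj (Λ (c w) (c v))

/-- Bilinear forms of Hilbert-Schmidt type. -/
def IsHilbertSchmidt (b : V →ₗ[ℂ] V →ₗ[ℂ] ℂ) : Prop :=
  ∃ α : PosHermForm V,
    (∀ v w, α.seminorm v = 0 ∨ α.seminorm w = 0 → b v w = 0) ∧
    ∀ (d : ℕ) (e : Fin d → V), (∀ i j, α.form (e i) (e j) = if i = j then 1 else 0) →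
      ∑ i, ∑ j, ‖b (e i) (e j)‖ ^ 2 ≤ 1

end Forms

/-! ## The tensor algebra -/

/-- The (algebraic) tensor algebra `⨁_k V^{⊗k}`; its multiplication is the tensor product. -/
abbrev TensorAlg (V : Type*) [AddCommGroup V] [Module ℂ V] : Type _ := ⨁ k : ℕ, ⨂[ℂ]^k V

section Algebraic

variable {V : Type*} [AddCommGroup V] [Module ℂ V]

/-- The homogeneous element `x` of degree `k`, as an element of the tensor algebra. -/
abbrev inDeg (k : ℕ) : ⨂[ℂ]^k V →ₗ[ℂ] TensorAlg V :=
  DirectSum.lof ℂ ℕ (fun k => ⨂[ℂ]^k V) k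

/-- The simple tensor `x_1 ⊗ ⋯ ⊗ x_k`, as an element of the tensor algebra. -/
abbrev simple {k : ℕ} (x : Fin k → V) : TensorAlg V := inDeg k (PiTensorProduct.tprod ℂ x)

theorem tensorAlg_induction {p : TensorAlg V → Prop} (X : TensorAlg V)
    (h0 : p 0) (hadd : ∀ X Y, p X → p Y → p (X + Y))
    (h : ∀ (r : ℂ) (k : ℕ) (x : Fin k → V), p (r • simple x)) : p X := by
  induction X using DirectSum.induction_on with
  | zero => exact h0
  | of k x =>
    induction x using PiTensorProduct.induction_on with
    | smul_tprod r f => have := h r k f; rwa [← map_smul] at this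
    | add x y hx hy => rw [map_add]; exact hadd _ _ hx hy
  | add x y hx hy => exact hadd _ _ hx hy

/-- The antilinear extension to `V^{⊗k}` of a map `φ` on `V^k` that is additive and antihomogeneous
in every variable. -/
def antiLift {k : ℕ} {E : Type*} [AddCommGroup E] [Module ℂ E] (φ : (Fin k → V) → E)
    (hadd : ∀ f i (x y : V), φ (Function.update f i (x + y)) =
      φ (Function.update f i x) + φ (Function.update f i y))
    (hsmul : ∀ f i (r : ℂ) (x : V), φ (Function.update f i (r • x)) =
      conj r • φ (Function.update f i x)) :
    ⨂[ℂ]^k V →ₗ⋆[ℂ] E :=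
  let F : ⨂[ℂ]^k V →+ E := PiTensorProduct.liftAddHom (fun p => conj p.1 • φ p.2)
    (fun r f i hi => by
      have h := hsmul f i 0 0
      have h' : Function.update f i (0 : V) = f := by rw [← hi, Function.update_eq_self]
      simp only [smul_zero, map_zero, zero_smul, h'] at h
      simp [h])
    (fun f => by simp)
    (fun {inst} r f i x y => by
      obtain rfl : inst = instDecidableEqFin k := Subsingleton.elim _ _
      simp only [hadd, smul_add])
    (fun r r' f => by simp [add_smul])
    (fun {inst} r f i r' => by
      obtain rfl : inst = instDecidableEqFin k := Subsingleton.elim _ _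
      simp only [hsmul, Function.update_eq_self, map_mul, mul_smul]
      rw [smul_comm])
  have hF : ∀ (r : ℂ) (f : Fin k → V), F (r • PiTensorProduct.tprod ℂ f) = conj r • φ f := by
    intro r f
    rw [← PiTensorProduct.tprodCoeff_eq_smul_tprod]
    rfl
  { F with
    map_smul' := fun r X => by
      induction X using PiTensorProduct.induction_on with
      | smul_tprod s f =>
        change F _ = _ • F _
        rw [smul_smul, hF, hF, map_mul, mul_smul]
      | add X Y hX hY =>
        change F _ = _ • F _ at hX
        change F _ = _ • F _ at hY
        change F _ = _ • F _
        rw [smul_add, map_add, map_add, smul_add, hX, hY] }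

theorem antiLift_tprod {k : ℕ} {E : Type*} [AddCommGroup E] [Module ℂ E] (φ : (Fin k → V) → E)
    (hadd) (hsmul) (f : Fin k → V) :
    antiLift φ hadd hsmul (PiTensorProduct.tprod ℂ f) = φ f := by
  have : antiLift φ hadd hsmul (PiTensorProduct.tprodCoeff ℂ 1 f) = conj (1 : ℂ) • φ f := rfl
  rw [PiTensorProduct.tprodCoeff_eq_smul_tprod] at this
  simpa using this

/-! ### Extension of sesquilinear forms -/

/-- The sesquilinear extension of `B` to `V^{⊗k}`, given by
`⟨x_1 ⊗ ⋯ ⊗ x_k, y_1 ⊗ ⋯ ⊗ y_k⟩ = k! ∏ B (x_m, y_m)`. -/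
def powForm (B : V →ₗ⋆[ℂ] V →ₗ[ℂ] ℂ) (k : ℕ) : ⨂[ℂ]^k V →ₗ⋆[ℂ] ⨂[ℂ]^k V →ₗ[ℂ] ℂ :=
  antiLift
    (fun x => (k.factorial : ℂ) • PiTensorProduct.lift
      ((MultilinearMap.mkPiAlgebra ℂ (Fin k) ℂ).compLinearMap fun m => B (x m)))
    (fun f i x y => by
      ext z
      simp only [LinearMap.compMultilinearMap_apply, LinearMap.smul_apply, LinearMap.add_apply,
        PiTensorProduct.lift.tprod, MultilinearMap.compLinearMap_apply,
        MultilinearMap.mkPiAlgebra_apply, ← smul_add]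
      congr 1
      rw [← Finset.mul_prod_erase _ _ (Finset.mem_univ i),
        ← Finset.mul_prod_erase _ _ (Finset.mem_univ i),
        ← Finset.mul_prod_erase _ _ (Finset.mem_univ i)]
      have h : ∀ v w : V, ∏ m ∈ Finset.univ.erase i, B (Function.update f i v m) (z m) =
          ∏ m ∈ Finset.univ.erase i, B (Function.update f i w m) (z m) := fun v w =>
        Finset.prod_congr rfl fun m hm => by
          rw [Function.update_of_ne (Finset.ne_of_mem_erase hm),
            Function.update_of_ne (Finset.ne_of_mem_erase hm)]
      rw [h (x + y) x, h y x]
      simp [add_mul])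
    (fun f i r x => by
      ext z
      simp only [LinearMap.compMultilinearMap_apply, LinearMap.smul_apply,
        PiTensorProduct.lift.tprod, MultilinearMap.compLinearMap_apply,
        MultilinearMap.mkPiAlgebra_apply]
      rw [smul_comm]
      congr 1
      rw [← Finset.mul_prod_erase _ _ (Finset.mem_univ i),
        ← Finset.mul_prod_erase _ _ (Finset.mem_univ i)]
      have h : ∏ m ∈ Finset.univ.erase i, B (Function.update f i (r • x) m) (z m) =
          ∏ m ∈ Finset.univ.erase i, B (Function.update f i x m) (z m) :=
        Finset.prod_congr rfl fun m hm => by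
          rw [Function.update_of_ne (Finset.ne_of_mem_erase hm),
            Function.update_of_ne (Finset.ne_of_mem_erase hm)]
      rw [h]
      simp [mul_assoc])

theorem powForm_tprod (B : V →ₗ⋆[ℂ] V →ₗ[ℂ] ℂ) {k : ℕ} (x y : Fin k → V) :
    powForm B k (PiTensorProduct.tprod ℂ x) (PiTensorProduct.tprod ℂ y) =
      k.factorial * ∏ m, B (x m) (y m) := by
  simp [powForm, antiLift_tprod]

/-- The sesquilinear extension `⟨X, Y⟩^• = ∑_k ⟨X_k, Y_k⟩^•` to the tensor algebra. -/
def tensorForm (B : V →ₗ⋆[ℂ] V →ₗ[ℂ] ℂ) : TensorAlg V →ₗ⋆[ℂ] TensorAlg V →ₗ[ℂ] ℂ where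
  toFun X := DirectSum.toModule ℂ ℕ ℂ fun k => powForm B k (X k)
  map_add' X Y := by ext; simp
  map_smul' r X := by ext; simp [DirectSum.smul_apply]

theorem tensorForm_apply (B : V →ₗ⋆[ℂ] V →ₗ[ℂ] ℂ) (X Y : TensorAlg V) :
    tensorForm B X Y = DirectSum.toModule ℂ ℕ ℂ (fun k => powForm B k (X k)) Y := rfl

open Classical in
theorem tensorForm_eq_sum (B : V →ₗ⋆[ℂ] V →ₗ[ℂ] ℂ) (X Y : TensorAlg V) :
    tensorForm B X Y = ∑ k ∈ DFinsupp.support Y, powForm B k (X k) (Y k) := by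
  rw [tensorForm_apply]
  conv_lhs => rw [← DirectSum.sum_support_of Y]
  rw [map_sum]
  refine Finset.sum_congr rfl fun k _ => ?_
  rw [← DirectSum.lof_eq_of ℂ]
  exact DirectSum.toModule_lof (M := fun k => ⨂[ℂ]^k V) ℂ k (Y k)

theorem powForm_conj_symm (B : V →ₗ⋆[ℂ] V →ₗ[ℂ] ℂ) (hsymm : ∀ v w, conj (B v w) = B w v) (k : ℕ)
    (X Y : ⨂[ℂ]^k V) : conj (powForm B k X Y) = powForm B k Y X := by
  induction X using PiTensorProduct.induction_on with
  | smul_tprod r x =>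
    induction Y using PiTensorProduct.induction_on with
    | smul_tprod s y =>
      simp only [map_smulₛₗ, LinearMap.smul_apply, powForm_tprod, smul_eq_mul, map_mul,
        Complex.conj_conj, map_prod, map_natCast, hsymm, RingHom.id_apply]
      ring
    | add Y Z hY hZ => simp only [map_add, LinearMap.add_apply, hY, hZ]
  | add X Z hX hZ => simp only [map_add, LinearMap.add_apply, hX, hZ]

open Classical in
theorem tensorForm_conj_symm (B : V →ₗ⋆[ℂ] V →ₗ[ℂ] ℂ) (hsymm : ∀ v w, conj (B v w) = B w v)
    (X Y : TensorAlg V) : conj (tensorForm B X Y) = tensorForm B Y X := by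
  have h : ∀ X Y : TensorAlg V, ∀ s : Finset ℕ, DFinsupp.support Y ⊆ s →
      tensorForm B X Y = ∑ k ∈ s, powForm B k (X k) (Y k) := by
    intro X Y s hs
    rw [tensorForm_eq_sum]
    refine Finset.sum_subset hs fun k _ hk => ?_
    rw [DFinsupp.notMem_support_iff] at hk
    rw [hk, map_zero]
  rw [h X Y (DFinsupp.support X ∪ DFinsupp.support Y) Finset.subset_union_right,
    h Y X (DFinsupp.support X ∪ DFinsupp.support Y) Finset.subset_union_left, map_sum]
  exact Finset.sum_congr rfl fun k _ => powForm_conj_symm B hsymm k _ _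

theorem prodForm_posSemidef (B : V →ₗ⋆[ℂ] V →ₗ[ℂ] ℂ) (hsymm : ∀ v w, conj (B v w) = B w v)
    (hpos : ∀ v, 0 ≤ B v v) {k : ℕ} (s : Finset (Fin k)) :
    (Matrix.of fun x y : Fin k → V => ∏ m ∈ s, B (x m) (y m)).PosSemidef := by
  classical
  have key : ∀ (c : (Fin k → V) →₀ ℂ) (g : (Fin k → V) → V),
      (c.sum fun i xi => c.sum fun j xj => star xi * B (g i) (g j) * xj) =
        B (c.sum fun i xi => xi • g i) (c.sum fun i xi => xi • g i) := by
    intro c g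
    simp only [Finsupp.sum, map_sum, LinearMap.sum_apply, map_smulₛₗ, LinearMap.smul_apply,
      smul_eq_mul, RingHom.id_apply, Finset.mul_sum]
    rw [Finset.sum_comm]
    refine Finset.sum_congr rfl fun i _ => Finset.sum_congr rfl fun j _ => ?_
    rw [starRingEnd_apply]
    ring
  induction s using Finset.induction_on with
  | empty =>
    refine ⟨by ext; simp, fun c => ?_⟩
    simp only [Finset.prod_empty, Matrix.of_apply, mul_one, Finsupp.sum, ← Finset.mul_sum,
      ← Finset.sum_mul, ← star_sum]
    exact star_mul_self_nonneg _
  | insert a s ha ih =>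
    have h1 : (Matrix.of fun x y : Fin k → V => B (x a) (y a)).PosSemidef := by
      refine ⟨by ext x y; simp [hsymm], fun c => ?_⟩
      simp only [Matrix.of_apply]
      rw [key c fun x => x a]
      exact hpos _
    have h2 : (Matrix.of fun x y : Fin k → V => ∏ m ∈ insert a s, B (x m) (y m)) =
        Matrix.hadamard (Matrix.of fun x y : Fin k → V => B (x a) (y a))
          (Matrix.of fun x y : Fin k → V => ∏ m ∈ s, B (x m) (y m)) := by
      ext x y
      simp [Finset.prod_insert ha]
    rw [h2]
    exact h1.hadamard ih

theorem powForm_nonneg (B : V →ₗ⋆[ℂ] V →ₗ[ℂ] ℂ) (hsymm : ∀ v w, conj (B v w) = B w v)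
    (hpos : ∀ v, 0 ≤ B v v) (k : ℕ) (X : ⨂[ℂ]^k V) : 0 ≤ powForm B k X X := by
  have hX : X ∈ Submodule.span ℂ (Set.range (PiTensorProduct.tprod ℂ (s := fun _ : Fin k => V))) := by
    rw [PiTensorProduct.span_tprod_eq_top]; trivial
  obtain ⟨c, rfl⟩ := Finsupp.mem_span_range_iff_exists_finsupp.mp hX
  have h := (prodForm_posSemidef B hsymm hpos (Finset.univ : Finset (Fin k))).2 c
  have h2 : (0 : ℂ) ≤ (k.factorial : ℂ) := by exact_mod_cast Nat.zero_le _
  convert mul_nonneg h2 h using 1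
  simp only [Finsupp.sum, map_sum, LinearMap.sum_apply, map_smulₛₗ, LinearMap.smul_apply,
    smul_eq_mul, RingHom.id_apply, powForm_tprod, Matrix.of_apply, Finset.mul_sum]
  rw [Finset.sum_comm]
  refine Finset.sum_congr rfl fun i _ => Finset.sum_congr rfl fun j _ => ?_
  rw [starRingEnd_apply]
  ring

theorem tensorForm_nonneg (B : V →ₗ⋆[ℂ] V →ₗ[ℂ] ℂ) (hsymm : ∀ v w, conj (B v w) = B w v)
    (hpos : ∀ v, 0 ≤ B v v) (X : TensorAlg V) : 0 ≤ tensorForm B X X := by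
  rw [tensorForm_eq_sum]
  exact Finset.sum_nonneg fun k _ => powForm_nonneg B hsymm hpos k _

/-! ### Symmetrisation -/

/-- The symmetrisation operator on `V^{⊗k}`:
`x_1 ⊗ ⋯ ⊗ x_k ↦ (1 / k!) ∑_σ x_{σ 1} ⊗ ⋯ ⊗ x_{σ k}`. -/
def powSym (k : ℕ) : ⨂[ℂ]^k V →ₗ[ℂ] ⨂[ℂ]^k V :=
  (k.factorial : ℂ)⁻¹ •
    ∑ σ : Equiv.Perm (Fin k), (PiTensorProduct.reindex ℂ (fun _ => V) σ.symm).toLinearMap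

theorem powSym_tprod {k : ℕ} (x : Fin k → V) :
    powSym k (PiTensorProduct.tprod ℂ x) =
      (k.factorial : ℂ)⁻¹ • ∑ σ : Equiv.Perm (Fin k), PiTensorProduct.tprod ℂ (fun i => x (σ i)) := by
  simp only [powSym, LinearMap.smul_apply, LinearMap.sum_apply, LinearEquiv.coe_coe]
  congr 1
  refine Finset.sum_congr rfl fun σ _ => ?_
  exact PiTensorProduct.reindex_tprod σ.symm x

/-- The symmetrisation operator on the tensor algebra. -/
def sym : TensorAlg V →ₗ[ℂ] TensorAlg V := DirectSum.lmap powSym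

variable (V) in
/-- The space of symmetric tensors, i.e. the image of the symmetrisation operator. -/
def symTensors : Submodule ℂ (TensorAlg V) := LinearMap.range sym

/-! ### The star product -/

/-- `μ_∨`: the tensor product, followed by symmetrisation. -/
def mulSym : TensorAlg V ⊗[ℂ] TensorAlg V →ₗ[ℂ] TensorAlg V :=
  sym ∘ₗ LinearMap.mul' ℂ (TensorAlg V)

/-- Splitting off the last factor: `x_1 ⊗ ⋯ ⊗ x_k ↦ k • (x_1 ⊗ ⋯ ⊗ x_{k-1}) ⊗ x_k` for `k ≥ 1`, and
zero on scalars. -/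
def splitLast : TensorAlg V →ₗ[ℂ] TensorAlg V ⊗[ℂ] V :=
  DirectSum.toModule ℂ ℕ _ fun k => match k with
    | 0 => 0
    | k + 1 => ((k + 1 : ℕ) : ℂ) • PiTensorProduct.lift (MultilinearMap.uncurryRight
        ((TensorProduct.mk ℂ (TensorAlg V) V ∘ₗ inDeg k).compMultilinearMap
          (PiTensorProduct.tprod ℂ)))

theorem splitLast_zero (x : Fin 0 → V) : splitLast (simple x) = 0 := by
  simp [splitLast, DirectSum.toModule_lof]

theorem splitLast_succ {k : ℕ} (x : Fin (k + 1) → V) :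
    splitLast (simple x) =
      ((k + 1 : ℕ) : ℂ) • (simple (fun i : Fin k => x i.castSucc) ⊗ₜ[ℂ] x (Fin.last k)) := by
  simp only [splitLast, DirectSum.toModule_lof, LinearMap.smul_apply, PiTensorProduct.lift.tprod]
  rfl

/-- Splitting off the first factor: `y_1 ⊗ ⋯ ⊗ y_l ↦ l • y_1 ⊗ (y_2 ⊗ ⋯ ⊗ y_l)` for `l ≥ 1`, and
zero on scalars. -/
def splitFirst : TensorAlg V →ₗ[ℂ] V ⊗[ℂ] TensorAlg V :=
  DirectSum.toModule ℂ ℕ _ fun l => match l with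
    | 0 => 0
    | l + 1 => ((l + 1 : ℕ) : ℂ) • PiTensorProduct.lift (LinearMap.uncurryLeft
        { toFun := fun v => (TensorProduct.mk ℂ V (TensorAlg V) v ∘ₗ inDeg l).compMultilinearMap
            (PiTensorProduct.tprod ℂ)
          map_add' := fun v w => by ext; simp
          map_smul' := fun r v => by ext; simp [TensorProduct.smul_tmul'] })

theorem splitFirst_zero (x : Fin 0 → V) : splitFirst (simple x) = 0 := by
  simp [splitFirst, DirectSum.toModule_lof]

theorem splitFirst_succ {l : ℕ} (y : Fin (l + 1) → V) :
    splitFirst (simple y) =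
      ((l + 1 : ℕ) : ℂ) • (y 0 ⊗ₜ[ℂ] simple (fun i : Fin l => y i.succ)) := by
  simp only [splitFirst, DirectSum.toModule_lof, LinearMap.smul_apply, PiTensorProduct.lift.tprod]
  rfl

/-- `(X ⊗ v) ⊗ (w ⊗ Y) ↦ Λ (v, w) • X ⊗ Y`. -/
def contract (Λ : V →ₗ[ℂ] V →ₗ[ℂ] ℂ) :
    (TensorAlg V ⊗[ℂ] V) ⊗[ℂ] (V ⊗[ℂ] TensorAlg V) →ₗ[ℂ] TensorAlg V ⊗[ℂ] TensorAlg V :=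
  TensorProduct.map
      ((TensorProduct.rid ℂ (TensorAlg V)).toLinearMap)
      (LinearMap.id) ∘ₗ
    (TensorProduct.map
      (LinearMap.lTensor (TensorAlg V) (TensorProduct.lift Λ)) LinearMap.id) ∘ₗ
    (TensorProduct.map (TensorProduct.assoc ℂ (TensorAlg V) V V).toLinearMap LinearMap.id) ∘ₗ
    (TensorProduct.assoc ℂ (TensorAlg V ⊗[ℂ] V) V (TensorAlg V)).symm.toLinearMap

theorem contract_tmul (Λ : V →ₗ[ℂ] V →ₗ[ℂ] ℂ) (X Y : TensorAlg V) (v w : V) :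
    contract Λ ((X ⊗ₜ v) ⊗ₜ (w ⊗ₜ Y)) = Λ v w • (X ⊗ₜ[ℂ] Y) := by
  simp [contract, TensorProduct.smul_tmul']

/-- The operator `P_Λ`, given on simple tensors of degrees `k, l ≥ 1` by
`(x_1 ⊗ ⋯ ⊗ x_k) ⊗ (y_1 ⊗ ⋯ ⊗ y_l) ↦
  k l Λ (x_k, y_1) • (x_1 ⊗ ⋯ ⊗ x_{k-1}) ⊗ (y_2 ⊗ ⋯ ⊗ y_l)`,
and zero if `k = 0` or `l = 0`. -/
def poisson (Λ : V →ₗ[ℂ] V →ₗ[ℂ] ℂ) :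
    TensorAlg V ⊗[ℂ] TensorAlg V →ₗ[ℂ] TensorAlg V ⊗[ℂ] TensorAlg V :=
  contract Λ ∘ₗ TensorProduct.map splitLast splitFirst

theorem poisson_zero_left (Λ : V →ₗ[ℂ] V →ₗ[ℂ] ℂ) (x : Fin 0 → V) (Y : TensorAlg V) :
    poisson Λ (simple x ⊗ₜ Y) = 0 := by
  rw [poisson, LinearMap.comp_apply, TensorProduct.map_tmul, splitLast_zero,
    TensorProduct.zero_tmul, map_zero]

theorem poisson_zero_right (Λ : V →ₗ[ℂ] V →ₗ[ℂ] ℂ) (X : TensorAlg V) (y : Fin 0 → V) :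
    poisson Λ (X ⊗ₜ simple y) = 0 := by
  rw [poisson, LinearMap.comp_apply, TensorProduct.map_tmul, splitFirst_zero,
    TensorProduct.tmul_zero, map_zero]

theorem poisson_succ (Λ : V →ₗ[ℂ] V →ₗ[ℂ] ℂ) {k l : ℕ} (x : Fin (k + 1) → V)
    (y : Fin (l + 1) → V) :
    poisson Λ (simple x ⊗ₜ simple y) =
      (((k + 1 : ℕ) : ℂ) * ((l + 1 : ℕ) : ℂ) * Λ (x (Fin.last k)) (y 0)) •
        (simple (fun i : Fin k => x i.castSucc) ⊗ₜ[ℂ] simple (fun i : Fin l => y i.succ)) := by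
  rw [poisson, LinearMap.comp_apply, TensorProduct.map_tmul, splitLast_succ, splitFirst_succ,
    TensorProduct.smul_tmul_smul, map_smul, contract_tmul, smul_smul]

theorem poisson_pow_simple (Λ : V →ₗ[ℂ] V →ₗ[ℂ] ℂ) (k : ℕ) : ∀ (t : ℕ), k < t →
    ∀ (x : Fin k → V) (l : ℕ) (y : Fin l → V), (poisson Λ ^ t) (simple x ⊗ₜ simple y) = 0 := by
  induction k with
  | zero =>
    intro t ht x l y
    obtain ⟨t, rfl⟩ := Nat.exists_eq_succ_of_ne_zero (Nat.ne_of_gt ht)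
    rw [Nat.succ_eq_add_one, pow_succ, Module.End.mul_apply, poisson_zero_left, map_zero]
  | succ k ih =>
    intro t ht x l y
    obtain ⟨t, rfl⟩ := Nat.exists_eq_succ_of_ne_zero (Nat.ne_of_gt (Nat.zero_lt_of_lt ht))
    rw [Nat.succ_eq_add_one, pow_succ, Module.End.mul_apply]
    cases l with
    | zero => rw [poisson_zero_right, map_zero]
    | succ l => rw [poisson_succ, map_smul, ih t (by omega), smul_zero]

/-- `P_Λ` is locally nilpotent. -/
theorem poisson_locally_nilpotent (Λ : V →ₗ[ℂ] V →ₗ[ℂ] ℂ) (Z : TensorAlg V ⊗[ℂ] TensorAlg V) :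
    ∃ N : ℕ, ∀ t, N ≤ t → (poisson Λ ^ t) Z = 0 := by
  have hadd : ∀ Z W : TensorAlg V ⊗[ℂ] TensorAlg V,
      (∃ N : ℕ, ∀ t, N ≤ t → (poisson Λ ^ t) Z = 0) →
      (∃ N : ℕ, ∀ t, N ≤ t → (poisson Λ ^ t) W = 0) →
      ∃ N : ℕ, ∀ t, N ≤ t → (poisson Λ ^ t) (Z + W) = 0 := by
    rintro Z W ⟨N, hN⟩ ⟨M, hM⟩
    refine ⟨max N M, fun t ht => ?_⟩
    rw [map_add, hN t (le_trans (le_max_left _ _) ht), hM t (le_trans (le_max_right _ _) ht),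
      add_zero]
  induction Z using TensorProduct.induction_on with
  | zero => exact ⟨0, fun t _ => map_zero _⟩
  | add Z W hZ hW => exact hadd Z W hZ hW
  | tmul X Y =>
    induction X using tensorAlg_induction with
    | h0 => exact ⟨0, fun t _ => by rw [TensorProduct.zero_tmul, map_zero]⟩
    | hadd X X' h h' => rw [TensorProduct.add_tmul]; exact hadd _ _ h h'
    | h r k x =>
      induction Y using tensorAlg_induction with
      | h0 => exact ⟨0, fun t _ => by rw [TensorProduct.tmul_zero, map_zero]⟩
      | hadd Y Y' h h' => rw [TensorProduct.tmul_add]; exact hadd _ _ h h'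
      | h s l y =>
        refine ⟨k + 1, fun t ht => ?_⟩
        rw [TensorProduct.smul_tmul_smul, map_smul, poisson_pow_simple Λ k t ht x l y, smul_zero]

/-- The summands of the star product. -/
abbrev starTerm (Λ : V →ₗ[ℂ] V →ₗ[ℂ] ℂ) (t : ℕ) : TensorAlg V ⊗[ℂ] TensorAlg V →ₗ[ℂ] TensorAlg V :=
  (t.factorial : ℂ)⁻¹ • (mulSym ∘ₗ poisson Λ ^ t)

/-- Only finitely many summands of the star product are different from zero. -/
theorem starTerm_finite (Λ : V →ₗ[ℂ] V →ₗ[ℂ] ℂ) (Z : TensorAlg V ⊗[ℂ] TensorAlg V) :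
    (Function.support fun t => starTerm Λ t Z).Finite := by
  obtain ⟨N, hN⟩ := poisson_locally_nilpotent Λ Z
  refine (Set.finite_lt_nat N).subset fun t ht => ?_
  by_contra h
  exact ht (by simp [starTerm, hN t (not_lt.mp h)])

/-- The map `μ_{⋆Λ} (Z) = ∑_t (1 / t!) μ_∨ (P_Λ^t Z)`; the sum is finite by `starTerm_finite`. -/
def mulStar (Λ : V →ₗ[ℂ] V →ₗ[ℂ] ℂ) : TensorAlg V ⊗[ℂ] TensorAlg V →ₗ[ℂ] TensorAlg V where
  toFun Z := ∑ᶠ t : ℕ, starTerm Λ t Z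
  map_add' Z W := by
    simp only [map_add]
    exact finsum_add_distrib (starTerm_finite Λ Z) (starTerm_finite Λ W)
  map_smul' r Z := by
    simp only [map_smul, RingHom.id_apply]
    exact (smul_finsum' r (starTerm_finite Λ Z)).symm

theorem mulStar_mem (Λ : V →ₗ[ℂ] V →ₗ[ℂ] ℂ) (Z : TensorAlg V ⊗[ℂ] TensorAlg V) :
    mulStar Λ Z ∈ symTensors V :=
  finsum_induction (fun X => X ∈ symTensors V) (Submodule.zero_mem _)
    (fun _ _ h h' => Submodule.add_mem _ h h')
    (fun _ => Submodule.smul_mem _ _ (LinearMap.mem_range_self sym _))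

/-- The star product `X ⋆_Λ Y` of symmetric tensors. -/
def starProd (Λ : V →ₗ[ℂ] V →ₗ[ℂ] ℂ) : symTensors V →ₗ[ℂ] symTensors V →ₗ[ℂ] symTensors V :=
  LinearMap.compr₂
    ((TensorProduct.mk ℂ (TensorAlg V) (TensorAlg V)).compl₁₂
      (symTensors V).subtype (symTensors V).subtype)
    ((mulStar Λ).codRestrict (symTensors V) (mulStar_mem Λ))

theorem starProd_coe (Λ : V →ₗ[ℂ] V →ₗ[ℂ] ℂ) (X Y : symTensors V) :
    (starProd Λ X Y : TensorAlg V) =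
      ∑ᶠ t : ℕ, (t.factorial : ℂ)⁻¹ •
        mulSym ((poisson Λ ^ t) ((X : TensorAlg V) ⊗ₜ[ℂ] (Y : TensorAlg V))) := rfl

/-! ### The involution -/

/-- The antilinear map `(x_1 ⊗ ⋯ ⊗ x_k)^* = x̄_k ⊗ ⋯ ⊗ x̄_1` on `V^{⊗k}`. -/
def powStar (c : V →ₗ⋆[ℂ] V) (k : ℕ) : ⨂[ℂ]^k V →ₗ⋆[ℂ] ⨂[ℂ]^k V :=
  antiLift (fun x => PiTensorProduct.tprod ℂ fun i => c (x i.rev))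
    (fun f i x y => by
      have h : ∀ v, (fun j : Fin k => c (Function.update f i v j.rev)) =
          Function.update (fun j : Fin k => c (f j.rev)) i.rev (c v) := by
        intro v; ext j
        by_cases hj : j = i.rev
        · subst hj; simp
        · rw [Function.update_of_ne hj,
            Function.update_of_ne fun h => hj (by rw [← h, Fin.rev_rev])]
      simp only [h, map_add, MultilinearMap.map_update_add])
    (fun f i r x => by
      have h : ∀ v, (fun j : Fin k => c (Function.update f i v j.rev)) =
          Function.update (fun j : Fin k => c (f j.rev)) i.rev (c v) := by
        intro v; ext j
        by_cases hj : j = i.rev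
        · subst hj; simp
        · rw [Function.update_of_ne hj,
            Function.update_of_ne fun h => hj (by rw [← h, Fin.rev_rev])]
      simp only [h, map_smulₛₗ, MultilinearMap.map_update_smul])

theorem powStar_tprod (c : V →ₗ⋆[ℂ] V) {k : ℕ} (x : Fin k → V) :
    powStar c k (PiTensorProduct.tprod ℂ x) = PiTensorProduct.tprod ℂ fun i => c (x i.rev) :=
  antiLift_tprod _ _ _ x

/-- The antilinear map `X ↦ X^*` on the tensor algebra. -/
def tensorStar (c : V →ₗ⋆[ℂ] V) : TensorAlg V →ₗ⋆[ℂ] TensorAlg V where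
  toFun := DirectSum.map fun k => (powStar c k).toAddMonoidHom
  map_add' X Y := map_add _ X Y
  map_smul' r X := by
    ext k : 1
    simp [DirectSum.map_apply, DirectSum.smul_apply]

theorem tensorStar_apply (c : V →ₗ⋆[ℂ] V) (X : TensorAlg V) (k : ℕ) :
    tensorStar c X k = powStar c k (X k) := rfl

theorem powStar_powSym (c : V →ₗ⋆[ℂ] V) (k : ℕ) (X : ⨂[ℂ]^k V) :
    powStar c k (powSym k X) = powSym k (powStar c k X) := by
  induction X using PiTensorProduct.induction_on with
  | smul_tprod r x =>
    simp only [map_smul, map_smulₛₗ, powSym_tprod, powStar_tprod, map_sum, map_inv₀, map_natCast]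
    congr 2
    refine Fintype.sum_equiv (Equiv.permCongr Fin.revPerm) _ _ fun σ => ?_
    congr 1
    ext i
    change _ = c (x (Fin.rev (Fin.rev (σ (Fin.rev i)))))
    rw [Fin.rev_rev]
  | add X Y hX hY => simp only [map_add, hX, hY]

theorem tensorStar_mem (c : V →ₗ⋆[ℂ] V) {X : TensorAlg V} (hX : X ∈ symTensors V) :
    tensorStar c X ∈ symTensors V := by
  obtain ⟨Y, rfl⟩ := hX
  refine ⟨tensorStar c Y, ?_⟩
  ext k : 1
  simp only [sym, DirectSum.lmap_apply, tensorStar_apply, powStar_powSym]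

/-- The antilinear map `X ↦ X^*` on symmetric tensors. -/
def symStar (c : V →ₗ⋆[ℂ] V) (X : symTensors V) : symTensors V :=
  ⟨tensorStar c X, tensorStar_mem c X.2⟩

end Algebraic

/-! ## The topology and continuous positive functionals -/

section Topological

variable {V : Type*} [AddCommGroup V] [Module ℂ V] [TopologicalSpace V]

/-- The extension `‖X‖^• = √⟨X, X⟩^•` of a continuous Hilbert seminorm to the tensor algebra. -/
def tensorSeminorm (α : PosHermForm V) : Seminorm ℂ (TensorAlg V) :=
  formSeminorm (tensorForm α.form) (tensorForm_conj_symm α.form α.conj_symm)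
    (tensorForm_nonneg α.form α.conj_symm α.nonneg)

variable (V) in
/-- The family of the extensions of all continuous Hilbert seminorms. -/
def tensorSeminormFamily : SeminormFamily ℂ (TensorAlg V) (PosHermForm V) := tensorSeminorm

/-- The locally convex topology on the tensor algebra, defined by the extensions of all continuous
Hilbert seminorms on `V`; the symmetric tensors carry the subspace topology. -/
instance tensorAlgTopology : TopologicalSpace (TensorAlg V) :=
  (tensorSeminormFamily V).moduleFilterBasis.topology

theorem tensorAlg_withSeminorms : WithSeminorms (tensorSeminormFamily V) := ⟨rfl⟩

/-- Positivity of a continuous linear functional on the symmetric tensors with respect to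
`⋆_Λ` and the involution: `ω (X^* ⋆_Λ X) ≥ 0` (in particular real) for all `X`. -/
def IsPositive (c : V →L⋆[ℂ] V) (Λ : V →ₗ[ℂ] V →ₗ[ℂ] ℂ) (ω : symTensors V →L[ℂ] ℂ) : Prop :=
  ∀ X : symTensors V, 0 ≤ ω (starProd Λ (symStar c.toLinearMap X) X)

end Topological

end

end HilbertStar

namespace HilbertStar

/-! ### Polarisation and powers of vectors -/

/-! Necessity. Let ω be a non-zero positive functional. Cauchy–Schwarz for (X, Y) ↦ ω(X* ⋆ Y) gives
ω(1) > 0, so b(v, w) = ω(v ∨ w) / ω(1) makes sense; it is symmetric, and Hermitian because ω(X*) is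
the conjugate of ω(X). Since v̄ ⋆ v = v̄ ∨ v + Λ(v̄, v), positivity on vectors is the inequality for
Λ + b. Continuity of ω on symmetric tensors of degree two, tested on ∑ conj b(e_i, e_j) e_i ⊗ e_j,
bounds the Hilbert–Schmidt norm of b (`exists_bilin_of_isPositive`).

Sufficiency. Given b and a functional ρ with ρ(v̄) = conj ρ(v), the Gaussian functional is formally
determined by ω(exp v) = exp(ρ(v) + b(v, v)/2). As exp v ⋆ exp w = exp(Λ(v, w)) exp(v + w), one
expects ω(exp v̄ ⋆ exp w) = conj(g(v)) g(w) exp((Λ + b)(v̄, w)) with g(v) = ω(exp v), which is a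
positive kernel by the Schur product theorem. The proof reads this off coefficientwise on powers of
vectors, which span the symmetric tensors (`gaussFunctional_mulStar`, `gaussFunctional_nonneg`).

Continuity is where Hilbert–Schmidt enters: b is then bounded on the Hilbert tensor square
(`hilbertSchmidt_posSemidef`), so products of copies of b and ρ are bounded on tensor powers, and
the weight k! in the tensor norm absorbs the Gaussian coefficients (`norm_gaussFunctional_le`).

Separation. Replacing ρ by sρ makes the value on X a polynomial in s, whose top coefficient is ρ ⊗ ⋯
⊗ ρ on the leading component of X. Polarisation and Hahn–Banach then force that component to vanish
(`eq_zero_of_gaussFunctional`). -/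

/-- The polarisation identity for multilinear maps. -/
theorem sum_neg_one_pow_multilinear {k : ℕ} {V E : Type*} [AddCommGroup V] [Module ℂ V]
    [AddCommGroup E] [Module ℂ E] (f : MultilinearMap ℂ (fun _ : Fin k => V) E) (x : Fin k → V) :
    ∑ u : Finset (Fin k), (-1 : ℤ) ^ u.card • f (fun _ => ∑ i ∈ uᶜ, x i) =
      ∑ σ : Equiv.Perm (Fin k), f (fun i => x (σ i)) := by
  classical
  -- Expansion gives the index maps r with values in uᶜ, that is, with u inside the complement of
  -- the image of r. For fixed r the signs of these u cancel unless that complement is empty, so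
  -- only bijections survive.
  have h1 : ∀ u : Finset (Fin k), (-1 : ℤ) ^ u.card • f (fun _ => ∑ i ∈ uᶜ, x i) =
      ∑ r : Fin k → Fin k, (if u ∈ ((Finset.univ.image r)ᶜ).powerset then (-1 : ℤ) ^ u.card else 0) •
        f (fun i => x (r i)) := by
    intro u
    rw [f.map_sum_finset (fun _ j => x j) (fun _ => uᶜ), Finset.smul_sum, ← Finset.sum_subset
      (Finset.subset_univ (Fintype.piFinset fun _ => uᶜ))]
    · refine Finset.sum_congr rfl fun r hr => ?_
      rw [if_pos]
      rw [Finset.mem_powerset, Finset.subset_compl_comm]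
      intro j hj
      obtain ⟨i, -, rfl⟩ := Finset.mem_image.mp hj
      exact Fintype.mem_piFinset.mp hr i
    · intro r _ hr
      rw [if_neg, zero_smul]
      intro h
      rw [Finset.mem_powerset, Finset.subset_compl_comm] at h
      exact hr (Fintype.mem_piFinset.mpr fun i =>
        h (Finset.mem_image_of_mem _ (Finset.mem_univ i)))
  simp only [h1]
  rw [Finset.sum_comm]
  simp only [← Finset.sum_smul, Finset.sum_ite_mem, Finset.univ_inter,
    Finset.sum_powerset_neg_one_pow_card]
  simp only [ite_smul, one_smul, zero_smul]
  rw [← Finset.sum_filter]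
  symm
  refine Finset.sum_bij (fun σ _ => (σ : Fin k → Fin k)) ?_ ?_ ?_ ?_
  · intro σ _
    simp [Finset.compl_eq_empty_iff, Finset.image_univ_of_surjective σ.surjective]
  · intro σ _ τ _ h
    exact DFunLike.coe_injective h
  · intro r hr
    have hs : Function.Surjective r := by
      simpa [Finset.compl_eq_empty_iff, Finset.eq_univ_iff_forall, Function.Surjective] using hr
    exact ⟨Equiv.ofBijective r (Finite.surjective_iff_bijective.mp hs), Finset.mem_univ _, rfl⟩
  · intro σ _
    rfl

noncomputable section

section Powers

variable {V : Type*} [AddCommGroup V] [Module ℂ V]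

/-- The power `v ⊗ ⋯ ⊗ v` of degree `k`. -/
def vpow (v : V) (k : ℕ) : TensorAlg V := simple fun _ : Fin k => v

theorem sym_inDeg {k : ℕ} (T : ⨂[ℂ]^k V) : sym (inDeg k T) = inDeg k (powSym k T) :=
  DirectSum.lmap_lof (f := fun k => (powSym k : ⨂[ℂ]^k V →ₗ[ℂ] ⨂[ℂ]^k V)) k T

theorem sym_simple {k : ℕ} (x : Fin k → V) :
    sym (simple x) = (k.factorial : ℂ)⁻¹ • ∑ σ : Equiv.Perm (Fin k), simple fun i => x (σ i) := by
  rw [sym_inDeg, powSym_tprod, map_smul, map_sum]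

/-- Allowing k and l to differ syntactically avoids casts when factors are regrouped along `Fin (a +
b) ≃ Fin n`. -/
theorem sym_simple_comp_equiv {k l : ℕ} (e : Fin k ≃ Fin l) (x : Fin l → V) :
    sym (simple fun i => x (e i)) = sym (simple x) := by
  obtain rfl : k = l := by simpa using Fintype.card_congr e
  rw [sym_simple, sym_simple]
  congr 1
  exact Fintype.sum_equiv (Equiv.mulLeft e) _ _ fun σ => rfl

theorem sym_vpow (v : V) (k : ℕ) : sym (vpow v k) = vpow v k := by
  rw [vpow, sym_simple]
  simp only [Finset.sum_const, Finset.card_univ, Fintype.card_perm, Fintype.card_fin]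
  rw [← Nat.cast_smul_eq_nsmul ℂ, inv_smul_smul₀]
  exact_mod_cast k.factorial_ne_zero

theorem vpow_mem (v : V) (k : ℕ) : vpow v k ∈ symTensors V := ⟨vpow v k, sym_vpow v k⟩

theorem simple_mul_simple {k l : ℕ} (x : Fin k → V) (y : Fin l → V) :
    simple x * simple y = simple (Fin.append x y) := by
  have := DirectSum.of_mul_of (A := fun k => ⨂[ℂ]^k V) (PiTensorProduct.tprod ℂ x)
    (PiTensorProduct.tprod ℂ y)
  exact this.trans (congrArg _ (TensorPower.tprod_mul_tprod ℂ x y))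

theorem vpow_zero (v : V) : vpow v 0 = 1 := by
  rw [vpow, simple, DirectSum.lof_eq_of]
  change _ = DirectSum.of _ 0 _
  congr 1
  exact congrArg _ (Subsingleton.elim _ _)

/-- The expansion of powers of a sum. -/
theorem vpow_smul_add (z : ℂ) (v w : V) (n : ℕ) :
    vpow (z • v + w) n = ∑ p ∈ Finset.HasAntidiagonal.antidiagonal n,
      (z ^ p.1 * (n.choose p.1 : ℂ)) • sym (vpow v p.1 * vpow w p.2) := by
  -- The words in z • v and w are indexed by the set s of positions of z • v; after symmetrisation
  -- only the size of s matters.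
  have key : ∀ s : Finset (Fin n), sym (simple (s.piecewise (fun _ => z • v) fun _ => w)) =
      z ^ s.card • sym (vpow v s.card * vpow w (n - s.card)) := by
    intro s
    have h1 : PiTensorProduct.tprod ℂ (s.piecewise (fun _ => z • v) fun _ => w) =
        z ^ s.card • PiTensorProduct.tprod ℂ (s.piecewise (fun _ => v) fun _ => w) := by
      have := (PiTensorProduct.tprod ℂ (s := fun _ : Fin n => V)).map_piecewise_smul
        (fun _ => z) (s.piecewise (fun _ => v) fun _ => w) s
      rw [Finset.prod_const] at this
      rw [← this]
      congr 1
      ext i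
      by_cases hi : i ∈ s <;> simp [hi]
    have h2 : sᶜ.card = n - s.card := by rw [Finset.card_compl, Fintype.card_fin]
    rw [simple, h1, map_smul, map_smul]
    congr 1
    -- This bijection lists the positions in s first, then those in its complement.
    let e : Fin (s.card + (n - s.card)) ≃ Fin n :=
      finSumFinEquiv.symm.trans (finSumEquivOfFinset rfl h2)
    rw [vpow, vpow, simple_mul_simple, ← simple, ← sym_simple_comp_equiv e]
    congr 2
    ext i
    refine Fin.addCases (fun j => ?_) (fun j => ?_) i
    · have : e (Fin.castAdd _ j) ∈ s := by simp [e]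
      simp [this]
    · have : e (Fin.natAdd _ j) ∉ s := by
        simp only [e, Equiv.trans_apply, finSumFinEquiv_symm_apply_natAdd,
          finSumEquivOfFinset_inr]
        exact Finset.mem_compl.mp (Finset.orderEmbOfFin_mem _ _ _)
      simp [this]
  have h3 : vpow (z • v + w) n =
      ∑ s : Finset (Fin n), sym (simple (s.piecewise (fun _ => z • v) fun _ => w)) := by
    rw [← sym_vpow, vpow, simple, ← map_sum, ← map_sum, ← MultilinearMap.map_add_univ]
    rfl
  rw [h3]
  simp only [key]
  rw [← Finset.powerset_univ, Finset.sum_powerset_apply_card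
    (fun m => z ^ m • sym (vpow v m * vpow w (n - m))), Finset.Nat.sum_antidiagonal_eq_sum_range_succ
      (fun p q => (z ^ p * (n.choose p : ℂ)) • sym (vpow v p * vpow w q))]
  simp only [Finset.card_univ, Fintype.card_fin]
  refine Finset.sum_congr rfl fun m _ => ?_
  rw [← Nat.cast_smul_eq_nsmul ℂ, smul_smul, mul_comm]

/-- Symmetric tensors are linear combinations of powers. -/
theorem symTensors_eq_span :
    symTensors V = Submodule.span ℂ (Set.range fun p : V × ℕ => vpow p.1 p.2) := by
  refine le_antisymm ?_ (Submodule.span_le.mpr (by rintro _ ⟨p, rfl⟩; exact vpow_mem _ _))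
  rintro _ ⟨X, rfl⟩
  induction X using tensorAlg_induction with
  | h0 => simp
  | hadd X Y hX hY => rw [map_add]; exact Submodule.add_mem _ hX hY
  | h r k x =>
    rw [map_smul, sym_simple]
    have := sum_neg_one_pow_multilinear
      ((inDeg k).compMultilinearMap (PiTensorProduct.tprod ℂ (s := fun _ : Fin k => V))) x
    simp only [LinearMap.compMultilinearMap_apply] at this
    rw [← this]
    refine Submodule.smul_mem _ _ (Submodule.smul_mem _ _ (Submodule.sum_mem _ fun u _ => ?_))
    rw [← Int.cast_smul_eq_zsmul ℂ]
    exact Submodule.smul_mem _ _ (Submodule.subset_span ⟨(_, k), rfl⟩)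

theorem exists_sum_vpow (X : symTensors V) :
    ∃ a : (V × ℕ) →₀ ℂ, (X : TensorAlg V) = a.sum fun p r => r • vpow p.1 p.2 := by
  have h := symTensors_eq_span.le X.2
  obtain ⟨a, ha⟩ := Finsupp.mem_span_range_iff_exists_finsupp.mp h
  exact ⟨a, ha.symm⟩

/-! ### The star product of powers -/

/-- Each contraction pairs a copy of v with a copy of w, and the prefactors of successive steps
multiply to falling factorials. These vanish once t exceeds k or l, so the truncated subtraction is
harmless. -/
theorem poisson_pow_vpow (Λ : V →ₗ[ℂ] V →ₗ[ℂ] ℂ) (v w : V) (t : ℕ) : ∀ k l : ℕ,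
    (poisson Λ ^ t) (vpow v k ⊗ₜ vpow w l) =
      ((k.descFactorial t : ℂ) * (l.descFactorial t : ℂ) * Λ v w ^ t) •
        (vpow v (k - t) ⊗ₜ[ℂ] vpow w (l - t)) := by
  induction t with
  | zero => intro k l; simp
  | succ t ih =>
    intro k l
    rw [pow_succ, Module.End.mul_apply]
    rcases k with _ | k
    · rw [vpow, poisson_zero_left]; simp
    rcases l with _ | l
    · rw [vpow, vpow, poisson_zero_right]; simp
    rw [vpow, vpow, poisson_succ, map_smul]
    change _ • (poisson Λ ^ t) (vpow v k ⊗ₜ vpow w l) = _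
    rw [ih, smul_smul, Nat.succ_descFactorial_succ, Nat.succ_descFactorial_succ,
      Nat.add_sub_add_right, Nat.add_sub_add_right]
    congr 1
    push_cast
    ring

theorem mulStar_vpow (Λ : V →ₗ[ℂ] V →ₗ[ℂ] ℂ) (v w : V) (k l N : ℕ) (hN : k < N) :
    mulStar Λ (vpow v k ⊗ₜ vpow w l) = ∑ t ∈ Finset.range N,
      ((t.factorial : ℂ)⁻¹ * ((k.descFactorial t : ℂ) * (l.descFactorial t : ℂ) * Λ v w ^ t)) •
        sym (vpow v (k - t) * vpow w (l - t)) := by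
  change ∑ᶠ t : ℕ, starTerm Λ t _ = _
  have h : ∀ t, starTerm Λ t (vpow v k ⊗ₜ vpow w l) =
      ((t.factorial : ℂ)⁻¹ * ((k.descFactorial t : ℂ) * (l.descFactorial t : ℂ) * Λ v w ^ t)) •
        sym (vpow v (k - t) * vpow w (l - t)) := by
    intro t
    rw [starTerm, LinearMap.smul_apply, LinearMap.comp_apply, poisson_pow_vpow, map_smul, smul_smul]
    rfl
  simp only [h]
  refine finsum_eq_sum_of_support_subset _ fun t ht => ?_
  by_contra hn
  refine ht ?_
  have : k < t := by simp at hn; omega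
  simp [Nat.descFactorial_of_lt this]

theorem tensorStar_simple (c : V →ₗ⋆[ℂ] V) {k : ℕ} (x : Fin k → V) :
    tensorStar c (simple x) = simple fun i => c (x i.rev) := by
  rw [simple, simple, ← powStar_tprod, DirectSum.lof_eq_of, DirectSum.lof_eq_of]
  exact DirectSum.map_of _ _ _

theorem tensorStar_vpow (c : V →ₗ⋆[ℂ] V) (v : V) (k : ℕ) :
    tensorStar c (vpow v k) = vpow (c v) k := tensorStar_simple c _

end Powers

end

noncomputable section

/-! ### Semi-definite sesquilinear forms -/

/-- Only the vanishing of the imaginary part at z = 0, 1, i is needed. -/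
theorem conj_eq_of_quadratic_nonneg {a p q s : ℂ} (hs : 0 ≤ s)
    (h : ∀ z : ℂ, 0 ≤ a + z * p + conj z * q + conj z * z * s) : q = conj p := by
  have h0 := (Complex.nonneg_iff.mp (h 0)).2
  have h1 := (Complex.nonneg_iff.mp (h 1)).2
  have h2 := (Complex.nonneg_iff.mp (h Complex.I)).2
  have h3 := (Complex.nonneg_iff.mp hs).2
  simp at h0 h1 h2
  apply Complex.ext
  · simp; linarith
  · simp; linarith

/-- The degenerate case of Cauchy–Schwarz: with no constant term, the linear part dominates near z =
0. For p ≠ 0 the point z = -conj p / (s + 1) gives |p|² / (s + 1) · (-2 + s / (s + 1)) < 0. -/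
theorem eq_zero_of_quadratic_nonneg {p q s : ℂ} (hs : 0 ≤ s)
    (h : ∀ z : ℂ, 0 ≤ z * p + conj z * q + conj z * z * s) : p = 0 := by
  have hq : q = conj p := conj_eq_of_quadratic_nonneg (a := 0) hs (by simpa using h)
  subst hq
  have hs' := (Complex.nonneg_iff.mp hs).1
  by_contra hp
  have hn : 0 < Complex.normSq p := Complex.normSq_pos.mpr hp
  have h1 := (Complex.nonneg_iff.mp (h (((-(s.re + 1)⁻¹ : ℝ) : ℂ) * conj p))).1
  have h2 : ((((-(s.re + 1)⁻¹ : ℝ) : ℂ) * conj p) * p +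
      conj (((-(s.re + 1)⁻¹ : ℝ) : ℂ) * conj p) * conj p +
      conj (((-(s.re + 1)⁻¹ : ℝ) : ℂ) * conj p) * (((-(s.re + 1)⁻¹ : ℝ) : ℂ) * conj p) * s).re =
      Complex.normSq p * (s.re + 1)⁻¹ * (-2 + (s.re + 1)⁻¹ * s.re) := by
    have e : ((((-(s.re + 1)⁻¹ : ℝ) : ℂ) * conj p) * p +
      conj (((-(s.re + 1)⁻¹ : ℝ) : ℂ) * conj p) * conj p +
      conj (((-(s.re + 1)⁻¹ : ℝ) : ℂ) * conj p) * (((-(s.re + 1)⁻¹ : ℝ) : ℂ) * conj p) * s) =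
      ((Complex.normSq p * (s.re + 1)⁻¹ : ℝ) : ℂ) * (-2 + ((s.re + 1)⁻¹ : ℝ) * s) := by
      push_cast
      simp only [Complex.normSq_eq_conj_mul_self, map_mul, Complex.conj_conj, map_neg, map_inv₀,
        map_add, Complex.conj_ofReal, map_one]
      ring
    rw [e, Complex.re_ofReal_mul, Complex.add_re, Complex.re_ofReal_mul]
    simp
  rw [h2] at h1
  have h3 : 0 < Complex.normSq p * (s.re + 1)⁻¹ := by positivity
  have h4 : (s.re + 1)⁻¹ * s.re ≤ 1 := by
    rw [inv_mul_le_iff₀ (by positivity)]; linarith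
  nlinarith

section Form

variable {E : Type*} [AddCommGroup E] [Module ℂ E] (B : E →ₗ⋆[ℂ] E →ₗ[ℂ] ℂ)

theorem form_eq_zero_of_left (hpos : ∀ v, 0 ≤ B v v) {v : E} (hv : B v v = 0) (w : E) :
    B v w = 0 := by
  refine eq_zero_of_quadratic_nonneg (q := B w v) (hpos w) fun z => ?_
  have := hpos (v + z • w)
  simp only [map_add, map_smul, map_smulₛₗ, LinearMap.add_apply, LinearMap.smul_apply,
    smul_eq_mul, hv] at this
  convert this using 1
  ring

theorem formSeminorm_sq (hsymm : ∀ v w, conj (B v w) = B w v) (hpos : ∀ v, 0 ≤ B v v) (v : E) :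
    formSeminorm B hsymm hpos v ^ 2 = (B v v).re := by
  rw [formSeminorm_apply, Real.sq_sqrt (Complex.nonneg_iff.mp (hpos v)).1]

theorem form_self_eq_re (hpos : ∀ v, 0 ≤ B v v) (v : E) : B v v = ((B v v).re : ℂ) :=
  Complex.ext rfl (Complex.nonneg_iff.mp (hpos v)).2.symm

theorem formSeminorm_eq_zero (hsymm : ∀ v w, conj (B v w) = B w v) (hpos : ∀ v, 0 ≤ B v v)
    {v : E} : formSeminorm B hsymm hpos v = 0 ↔ B v v = 0 := by
  rw [← sq_eq_zero_iff, formSeminorm_sq, form_self_eq_re B hpos v, Complex.ofReal_re,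
    Complex.ofReal_eq_zero]

end Form

namespace PosHermForm

variable {V : Type*} [AddCommGroup V] [Module ℂ V] [TopologicalSpace V]

theorem seminorm_eq_zero (α : PosHermForm V) {v : V} : α.seminorm v = 0 ↔ α.form v v = 0 :=
  formSeminorm_eq_zero _ _ _

/-- The sum of two continuous positive Hermitian forms. -/
def add (α β : PosHermForm V) : PosHermForm V where
  form := α.form + β.form
  conj_symm v w := by simp [α.conj_symm, β.conj_symm]
  nonneg v := add_nonneg (α.nonneg v) (β.nonneg v)
  cont := α.cont.add β.cont

/-- A non-negative multiple of a continuous positive Hermitian form. -/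
def scale (r : ℝ) (hr : 0 ≤ r) (α : PosHermForm V) : PosHermForm V where
  form := (r : ℂ) • α.form
  conj_symm v w := by simp [α.conj_symm]
  nonneg v := mul_nonneg (by exact_mod_cast hr) (α.nonneg v)
  cont := α.cont.const_smul (r : ℂ)

/-- The form of rank one belonging to a continuous linear functional. -/
def ofFunctional (ρ : V →L[ℂ] ℂ) : PosHermForm V where
  form := LinearMap.mk₂'ₛₗ (starRingEnd ℂ) (RingHom.id ℂ) (fun v w => conj (ρ v) * ρ w)
    (by intros; simp [add_mul]) (by intros; simp [mul_assoc])
    (by intros; simp [mul_add]) (by intros; simp [mul_left_comm])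
  conj_symm v w := by simp [mul_comm]
  nonneg v := star_mul_self_nonneg (ρ v)
  cont := by
    change Continuous fun p : V × V => conj (ρ p.1) * ρ p.2
    have := ρ.continuous
    exact (Complex.continuous_conj.comp (this.comp continuous_fst)).mul (this.comp continuous_snd)

/-- Sums make the forms directed, so a continuous functional is bounded by a single tensor seminorm
rather than by a finite supremum. -/
theorem exists_forall_le (s : Finset (PosHermForm V)) :
    ∃ γ : PosHermForm V, ∀ α ∈ s, ∀ v, α.form v v ≤ γ.form v v := by
  classical
  induction s using Finset.induction_on with
  | empty => exact ⟨Classical.arbitrary _, by simp⟩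
  | insert a s _ ih =>
    obtain ⟨γ, hγ⟩ := ih
    refine ⟨a.add γ, fun α hα v => ?_⟩
    change _ ≤ a.form v v + γ.form v v
    rcases Finset.mem_insert.mp hα with rfl | h
    · exact le_add_of_nonneg_right (γ.nonneg v)
    · exact (hγ α h v).trans (le_add_of_nonneg_left (a.nonneg v))

end PosHermForm

/-! ### Positive semi-definite kernels -/

section Kernel

variable {V : Type*} [AddCommGroup V] [Module ℂ V]

theorem form_posSemidef (B : V →ₗ⋆[ℂ] V →ₗ[ℂ] ℂ) (hsymm : ∀ v w, conj (B v w) = B w v)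
    (hpos : ∀ v, 0 ≤ B v v) {ι : Type*} (g : ι → V) :
    (Matrix.of fun i j : ι => B (g i) (g j)).PosSemidef := by
  have h := (prodForm_posSemidef B hsymm hpos (k := 1) Finset.univ).submatrix fun i _ => g i
  convert h using 1
  ext i j
  simp

theorem powForm_sum_tprod (B : V →ₗ⋆[ℂ] V →ₗ[ℂ] ℂ) {n : ℕ} (a : (Fin n → V) →₀ ℂ) :
    powForm B n (a.sum fun x r => r • PiTensorProduct.tprod ℂ x)
      (a.sum fun x r => r • PiTensorProduct.tprod ℂ x) =
      n.factorial * a.sum fun x r => a.sum fun y s => star r * (∏ m, B (x m) (y m)) * s := by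
  simp only [Finsupp.sum, map_sum, LinearMap.sum_apply, map_smulₛₗ, LinearMap.smul_apply,
    smul_eq_mul, RingHom.id_apply, powForm_tprod, Finset.mul_sum]
  rw [Finset.sum_comm]
  refine Finset.sum_congr rfl fun i _ => Finset.sum_congr rfl fun j _ => ?_
  rw [starRingEnd_apply]
  ring

theorem exists_sum_tprod {n : ℕ} (X : ⨂[ℂ]^n V) :
    ∃ a : (Fin n → V) →₀ ℂ, X = a.sum fun x r => r • PiTensorProduct.tprod ℂ x := by
  have hX : X ∈ Submodule.span ℂ (Set.range (PiTensorProduct.tprod ℂ (s := fun _ : Fin n => V))) := by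
    rw [PiTensorProduct.span_tprod_eq_top]; trivial
  obtain ⟨c, hc⟩ := Finsupp.mem_span_range_iff_exists_finsupp.mp hX
  exact ⟨c, hc.symm⟩

/-- Telescoping, A∘C - A'∘C' = (A - A')∘C + A'∘(C - C'), followed by the Schur product theorem. All
comparisons of tensor products of kernels below rest on it. -/
theorem hadamard_sub_posSemidef {ι : Type*} {A A' C C' : Matrix ι ι ℂ}
    (hA : (A - A').PosSemidef) (hC : C.PosSemidef) (hA' : A'.PosSemidef)
    (hC' : (C - C').PosSemidef) :
    (Matrix.hadamard A C - Matrix.hadamard A' C').PosSemidef := by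
  have e : Matrix.hadamard A C - Matrix.hadamard A' C' =
      Matrix.hadamard (A - A') C + Matrix.hadamard A' (C - C') := by
    ext i j
    simp
    ring
  rw [e]
  exact (hA.hadamard hC).add (hA'.hadamard hC')

theorem prodForm_sub_posSemidef (B B' : V →ₗ⋆[ℂ] V →ₗ[ℂ] ℂ)
    (hsymm : ∀ v w, conj (B v w) = B w v) (hpos : ∀ v, 0 ≤ B v v)
    (hsymm' : ∀ v w, conj (B' v w) = B' w v) (hle : ∀ v, B v v ≤ B' v v) {k : ℕ}
    (s : Finset (Fin k)) :
    ((Matrix.of fun x y : Fin k → V => ∏ m ∈ s, B' (x m) (y m)) -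
      Matrix.of fun x y : Fin k → V => ∏ m ∈ s, B (x m) (y m)).PosSemidef := by
  classical
  induction s using Finset.induction_on with
  | empty => simpa using Matrix.PosSemidef.zero
  | insert a s ha ih =>
    have h1 := form_posSemidef (B' - B) (by simp [hsymm, hsymm']) (by simpa using hle)
      fun x : Fin k → V => x a
    have h2 := form_posSemidef B hsymm hpos fun x : Fin k → V => x a
    have h3 := prodForm_posSemidef B' hsymm' (fun v => (hpos v).trans (hle v)) s
    convert hadamard_sub_posSemidef (A := Matrix.of fun x y : Fin k → V => B' (x a) (y a))
      (A' := Matrix.of fun x y : Fin k → V => B (x a) (y a)) (by convert h1 using 1; ext; simp) h3 h2 ih using 1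
    ext x y
    simp [Finset.prod_insert ha]

theorem powForm_mono (B B' : V →ₗ⋆[ℂ] V →ₗ[ℂ] ℂ)
    (hsymm : ∀ v w, conj (B v w) = B w v) (hpos : ∀ v, 0 ≤ B v v)
    (hsymm' : ∀ v w, conj (B' v w) = B' w v) (hle : ∀ v, B v v ≤ B' v v) (n : ℕ) (X : ⨂[ℂ]^n V) :
    powForm B n X X ≤ powForm B' n X X := by
  obtain ⟨a, rfl⟩ := exists_sum_tprod X
  rw [powForm_sum_tprod, powForm_sum_tprod]
  refine mul_le_mul_of_nonneg_left ?_ (by exact_mod_cast Nat.zero_le _)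
  have h := (prodForm_sub_posSemidef B B' hsymm hpos hsymm' hle (k := n) Finset.univ).2 a
  rw [← sub_nonneg]
  convert h using 1
  simp only [Finsupp.sum, ← Finset.sum_sub_distrib]
  refine Finset.sum_congr rfl fun i _ => Finset.sum_congr rfl fun j _ => ?_
  simp
  ring

theorem tensorForm_mono (B B' : V →ₗ⋆[ℂ] V →ₗ[ℂ] ℂ)
    (hsymm : ∀ v w, conj (B v w) = B w v) (hpos : ∀ v, 0 ≤ B v v)
    (hsymm' : ∀ v w, conj (B' v w) = B' w v) (hle : ∀ v, B v v ≤ B' v v) (X : TensorAlg V) :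
    tensorForm B X X ≤ tensorForm B' X X := by
  rw [tensorForm_eq_sum, tensorForm_eq_sum]
  exact Finset.sum_le_sum fun n _ => powForm_mono B B' hsymm hpos hsymm' hle n _

theorem tensorForm_inDeg (B : V →ₗ⋆[ℂ] V →ₗ[ℂ] ℂ) {n : ℕ} (X Y : ⨂[ℂ]^n V) :
    tensorForm B (inDeg n X) (inDeg n Y) = powForm B n X Y := by
  rw [tensorForm_apply, inDeg, DirectSum.toModule_lof, DirectSum.lof_apply]

end Kernel

/-! ### Continuous functionals on symmetric tensors -/

section Continuity

variable {V : Type*} [AddCommGroup V] [Module ℂ V] [TopologicalSpace V]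

theorem tensorSeminorm_apply (α : PosHermForm V) (X : TensorAlg V) :
    tensorSeminorm α X = √(tensorForm α.form X X).re := rfl

theorem tensorSeminorm_mono {α β : PosHermForm V} (h : ∀ v, α.form v v ≤ β.form v v) :
    tensorSeminorm α ≤ tensorSeminorm β := fun X => by
  rw [tensorSeminorm_apply, tensorSeminorm_apply]
  exact Real.sqrt_le_sqrt (Complex.le_def.mp
    (tensorForm_mono _ _ α.conj_symm α.nonneg β.conj_symm h X)).1

theorem exists_tensorSeminorm_bound (ω : symTensors V →L[ℂ] ℂ) :
    ∃ (γ : PosHermForm V) (C : ℝ), 0 ≤ C ∧ ∀ X, ‖ω X‖ ≤ C * tensorSeminorm γ X := by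
  have hs := LinearMap.withSeminorms_induced (𝕜 := ℂ) (E := symTensors V) (F := TensorAlg V)
    (tensorAlg_withSeminorms (V := V)) (symTensors V).subtype
  obtain ⟨s, C, -, hC⟩ := Seminorm.bound_of_continuous hs
    ((normSeminorm ℂ ℂ).comp ω.toLinearMap) (continuous_norm.comp ω.continuous)
  obtain ⟨γ, hγ⟩ := PosHermForm.exists_forall_le s
  refine ⟨γ, C, C.2, fun X => (hC X).trans ?_⟩
  rw [smul_apply, NNReal.smul_def, smul_eq_mul]
  refine mul_le_mul_of_nonneg_left ?_ C.2
  exact Seminorm.finset_sup_apply_le (apply_nonneg _ _) fun α hα => tensorSeminorm_mono (hγ α hα) _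

end Continuity

end

noncomputable section

/-! ### Units, low degrees and the quadratic expansion of the star product -/

section Forward

variable {V : Type*} [AddCommGroup V] [Module ℂ V]

theorem sym_of_mem {X : TensorAlg V} (hX : X ∈ symTensors V) : sym X = X := by
  rw [symTensors_eq_span] at hX
  induction hX using Submodule.span_induction with
  | mem x h => obtain ⟨p, rfl⟩ := h; exact sym_vpow _ _
  | zero => exact map_zero _
  | add x y _ _ hx hy => rw [map_add, hx, hy]
  | smul r x _ hx => rw [map_smul, hx]

/-- The extension of a linear functional on symmetric tensors to the tensor algebra by means of
the symmetrisation operator. -/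
def symExtend (ω : symTensors V →ₗ[ℂ] ℂ) : TensorAlg V →ₗ[ℂ] ℂ := ω ∘ₗ sym.rangeRestrict

theorem symExtend_coe (ω : symTensors V →ₗ[ℂ] ℂ) (X : symTensors V) :
    symExtend ω X = ω X :=
  congrArg ω (Subtype.ext (sym_of_mem X.2))

theorem symExtend_of_mem (ω : symTensors V →ₗ[ℂ] ℂ) {X : TensorAlg V} (hX : X ∈ symTensors V) :
    symExtend ω X = ω ⟨X, hX⟩ := symExtend_coe ω ⟨X, hX⟩

theorem symExtend_sym (ω : symTensors V →ₗ[ℂ] ℂ) (X : TensorAlg V) :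
    symExtend ω (sym X) = symExtend ω X := by
  rw [symExtend_of_mem ω (LinearMap.mem_range_self sym X)]; rfl

theorem sym_tensorStar (c : V →ₗ⋆[ℂ] V) (X : TensorAlg V) :
    sym (tensorStar c X) = tensorStar c (sym X) := by
  ext k : 1
  simp only [sym, DirectSum.lmap_apply, tensorStar_apply, powStar_powSym]

theorem one_mem_symTensors : (1 : TensorAlg V) ∈ symTensors V := vpow_zero (0 : V) ▸ vpow_mem 0 0

theorem mulStar_one_left (Λ : V →ₗ[ℂ] V →ₗ[ℂ] ℂ) {X : TensorAlg V} (hX : X ∈ symTensors V) :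
    mulStar Λ (1 ⊗ₜ X) = X := by
  rw [symTensors_eq_span] at hX
  induction hX using Submodule.span_induction with
  | mem x h =>
    obtain ⟨⟨w, l⟩, rfl⟩ := h
    rw [← vpow_zero (0 : V), mulStar_vpow Λ 0 w 0 l 1 one_pos]
    simp [vpow_zero, sym_vpow]
  | zero => simp
  | add x y _ _ hx hy => rw [TensorProduct.tmul_add, map_add, hx, hy]
  | smul r x _ hx => rw [TensorProduct.tmul_smul, map_smul, hx]

theorem mulStar_one_right (Λ : V →ₗ[ℂ] V →ₗ[ℂ] ℂ) {X : TensorAlg V} (hX : X ∈ symTensors V) :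
    mulStar Λ (X ⊗ₜ 1) = X := by
  rw [symTensors_eq_span] at hX
  induction hX using Submodule.span_induction with
  | mem x h =>
    obtain ⟨⟨w, l⟩, rfl⟩ := h
    rw [← vpow_zero (0 : V), mulStar_vpow Λ w 0 l 0 (l + 1) (Nat.lt_succ_self l),
      Finset.sum_range_succ', Finset.sum_eq_zero]
    · simp [vpow_zero, sym_vpow]
    · intro t _; simp
  | zero => simp
  | add x y _ _ hx hy => rw [TensorProduct.add_tmul, map_add, hx, hy]
  | smul r x _ hx => rw [← TensorProduct.smul_tmul', map_smul, hx]

theorem mulStar_vpow_one (Λ : V →ₗ[ℂ] V →ₗ[ℂ] ℂ) (v w : V) :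
    mulStar Λ (vpow v 1 ⊗ₜ vpow w 1) = sym (vpow v 1 * vpow w 1) + Λ v w • 1 := by
  rw [mulStar_vpow Λ v w 1 1 2 one_lt_two, Finset.sum_range_succ, Finset.sum_range_one]
  simp [vpow_zero, sym_of_mem one_mem_symTensors]

theorem tensorStar_one (c : V →ₗ⋆[ℂ] V) : tensorStar c 1 = 1 := by
  rw [← vpow_zero (0 : V), tensorStar_vpow, vpow_zero, vpow_zero]

/-- The inclusion of `V` into its tensor algebra. -/
def inclV : V →ₗ[ℂ] TensorAlg V :=
  inDeg 1 ∘ₗ (PiTensorProduct.subsingletonEquiv (R := ℂ) (s := fun _ => V) (0 : Fin 1)).symm.toLinearMap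

theorem inclV_apply (v : V) : inclV v = vpow v 1 := by
  simp only [inclV, vpow, simple, LinearMap.comp_apply, LinearEquiv.coe_coe,
    PiTensorProduct.subsingletonEquiv_symm_apply]
  congr 2
  ext i
  obtain rfl := Subsingleton.elim 0 i
  simp

theorem vpow_one_mul (v w : V) : vpow v 1 * vpow w 1 = simple ![v, w] := by
  rw [vpow, vpow, simple_mul_simple]
  congr 2
  ext i
  fin_cases i <;> rfl

theorem sym_pair_comm (v w : V) : sym (simple ![v, w]) = sym (simple ![w, v]) := by
  rw [← sym_simple_comp_equiv (Equiv.swap 0 1) ![w, v]]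
  congr 2
  ext i
  fin_cases i <;> rfl

theorem sym_pair (v w : V) :
    sym (simple ![v, w]) = (2 : ℂ)⁻¹ • (simple ![v, w] + simple ![w, v]) := by
  rw [sym_simple]
  have h : (Finset.univ : Finset (Equiv.Perm (Fin 2))) = {1, Equiv.swap 0 1} := by decide
  rw [h, Finset.sum_pair (by decide)]
  have e1 : (fun i => ![v, w] ((1 : Equiv.Perm (Fin 2)) i)) = ![v, w] := rfl
  have e2 : (fun i => ![v, w] (Equiv.swap (0 : Fin 2) 1 i)) = ![w, v] := by
    ext i; fin_cases i <;> rfl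
  rw [e1, e2]
  simp

/-- Exchanging i and j; it admits the test tensor of the Hilbert–Schmidt estimate as a symmetric
tensor. -/
theorem sym_inDeg_two_sum {d : ℕ} (e : Fin d → V) (a : Fin d → Fin d → ℂ)
    (ha : ∀ i j, a i j = a j i) :
    sym (inDeg 2 (∑ i, ∑ j, a i j • PiTensorProduct.tprod ℂ ![e i, e j])) =
      inDeg 2 (∑ i, ∑ j, a i j • PiTensorProduct.tprod ℂ ![e i, e j]) := by
  simp only [map_sum, map_smul]
  change ∑ i, ∑ j, a i j • sym (simple ![e i, e j]) = ∑ i, ∑ j, a i j • simple ![e i, e j]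
  simp only [sym_pair, smul_add, Finset.sum_add_distrib]
  have h : ∑ i, ∑ j, a i j • (2 : ℂ)⁻¹ • simple ![e j, e i] =
      ∑ i, ∑ j, a i j • (2 : ℂ)⁻¹ • simple ![e i, e j] := by
    rw [Finset.sum_comm]
    simp only [ha]
  rw [h]
  simp only [← Finset.sum_add_distrib, ← smul_add, ← two_smul ℂ (simple _), smul_smul]
  refine Finset.sum_congr rfl fun i _ => Finset.sum_congr rfl fun j _ => ?_
  congr 1
  ring

theorem tensorStar_pair (c : V →ₗ⋆[ℂ] V) (v w : V) :
    tensorStar c (simple ![v, w]) = simple ![c w, c v] := by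
  rw [tensorStar_simple]
  congr 2
  ext i
  fin_cases i <;> rfl

/-- The sesquilinear form `(X, Y) ↦ ω (X^* ⋆ Y)` is non-negative on the diagonal and can be
evaluated on `X + z • Y`. -/
theorem functional_quadratic (Λ : V →ₗ[ℂ] V →ₗ[ℂ] ℂ) (c : V →ₗ⋆[ℂ] V) (φ : TensorAlg V →ₗ[ℂ] ℂ)
    {X : TensorAlg V} (hX : X ∈ symTensors V) (z : ℂ) :
    φ (mulStar Λ (tensorStar c (1 + z • X) ⊗ₜ (1 + z • X))) =
      φ 1 + z * φ X + conj z * φ (tensorStar c X) +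
        conj z * z * φ (mulStar Λ (tensorStar c X ⊗ₜ X)) := by
  simp only [map_add, map_smulₛₗ, tensorStar_one, TensorProduct.add_tmul, TensorProduct.tmul_add,
    TensorProduct.tmul_smul, ← TensorProduct.smul_tmul', mulStar_one_left Λ hX,
    mulStar_one_left Λ one_mem_symTensors, mulStar_one_right Λ (tensorStar_mem c hX),
    smul_eq_mul, RingHom.id_apply]
  ring

/-- The tensors e_i ⊗ e_j are orthogonal with squared norm 2!, whence the factor 2. -/
theorem powForm_two_sum (B : V →ₗ⋆[ℂ] V →ₗ[ℂ] ℂ) {d : ℕ} (e : Fin d → V)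
    (he : ∀ i j, B (e i) (e j) = if i = j then 1 else 0) (a : Fin d → Fin d → ℂ) :
    powForm B 2 (∑ i, ∑ j, a i j • PiTensorProduct.tprod ℂ ![e i, e j])
      (∑ i, ∑ j, a i j • PiTensorProduct.tprod ℂ ![e i, e j]) =
      ((2 * ∑ i, ∑ j, ‖a i j‖ ^ 2 : ℝ) : ℂ) := by
  simp only [map_sum, LinearMap.sum_apply, map_smulₛₗ, LinearMap.smul_apply,
    smul_eq_mul, RingHom.id_apply, powForm_tprod, Fin.prod_univ_two, Matrix.cons_val_zero,
    Matrix.cons_val_one, he]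
  simp only [mul_ite, mul_one, mul_zero, Finset.mem_univ, if_true, Finset.sum_ite_eq']
  push_cast
  rw [Finset.mul_sum]
  refine Finset.sum_congr rfl fun i _ => ?_
  rw [Finset.mul_sum]
  refine Finset.sum_congr rfl fun j _ => ?_
  have h : ((‖a i j‖ : ℂ)) ^ 2 = conj (a i j) * a i j := by
    rw [← Complex.normSq_eq_conj_mul_self, Complex.normSq_eq_norm_sq]; push_cast; rfl
  rw [h]
  simp [Nat.factorial]
  ring

end Forward

/-! ### From positive functionals to Hilbert–Schmidt forms -/

section Positive

variable {V : Type*} [AddCommGroup V] [Module ℂ V] [TopologicalSpace V]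

theorem isPositive_iff (c : V →L⋆[ℂ] V) (Λ : V →ₗ[ℂ] V →ₗ[ℂ] ℂ) (ω : symTensors V →L[ℂ] ℂ) :
    IsPositive c Λ ω ↔ ∀ X ∈ symTensors V,
      0 ≤ symExtend ω.toLinearMap (mulStar Λ (tensorStar c.toLinearMap X ⊗ₜ X)) := by
  refine ⟨fun h X hX => ?_, fun h X => ?_⟩
  · rw [symExtend_of_mem _ (mulStar_mem Λ _)]
    exact h ⟨X, hX⟩
  · have := h X X.2
    rw [symExtend_of_mem _ (mulStar_mem Λ _)] at this
    exact this

variable {c : V →L⋆[ℂ] V} {Λ : V →ₗ[ℂ] V →ₗ[ℂ] ℂ} {ω : symTensors V →L[ℂ] ℂ}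

theorem IsPositive.quadratic (h : IsPositive c Λ ω) {X : TensorAlg V} (hX : X ∈ symTensors V)
    (z : ℂ) : 0 ≤ symExtend ω.toLinearMap 1 + z * symExtend ω.toLinearMap X +
      conj z * symExtend ω.toLinearMap (tensorStar c.toLinearMap X) + conj z * z *
        symExtend ω.toLinearMap (mulStar Λ (tensorStar c.toLinearMap X ⊗ₜ X)) := by
  rw [← functional_quadratic Λ _ _ hX]
  exact (isPositive_iff c Λ ω).mp h _
    (Submodule.add_mem _ one_mem_symTensors (Submodule.smul_mem _ _ hX))

theorem IsPositive.map_star (h : IsPositive c Λ ω) {X : TensorAlg V} (hX : X ∈ symTensors V) :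
    symExtend ω.toLinearMap (tensorStar c.toLinearMap X) = conj (symExtend ω.toLinearMap X) :=
  conj_eq_of_quadratic_nonneg ((isPositive_iff c Λ ω).mp h X hX) (h.quadratic hX)

/-- If ω(1) vanished, the quadratic expression in z obtained from 1 + z • X would have no constant
term, forcing ω(X) = 0 for every X. -/
theorem IsPositive.map_one_pos (h : IsPositive c Λ ω) (hω : ω ≠ 0) :
    0 < symExtend ω.toLinearMap 1 := by
  have h0 : 0 ≤ symExtend ω.toLinearMap 1 := by
    simpa using h.quadratic one_mem_symTensors 0
  refine lt_of_le_of_ne h0 fun h1 => hω ?_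
  ext X
  rw [zero_apply]
  have := eq_zero_of_quadratic_nonneg ((isPositive_iff c Λ ω).mp h X X.2) fun z => by
    simpa [← h1] using h.quadratic X.2 z
  rwa [symExtend_coe] at this

/-- A symmetric bilinear form given by a bounded functional on tensors of degree two is of
Hilbert-Schmidt type. -/
theorem isHilbertSchmidt_of_bound (b : V →ₗ[ℂ] V →ₗ[ℂ] ℂ) (hb : ∀ v w, b v w = b w v)
    (φ : TensorAlg V →ₗ[ℂ] ℂ) (hφ : ∀ v w, b v w = φ (simple ![v, w])) (γ : PosHermForm V) (D : ℝ)
    (hD : ∀ T : ⨂[ℂ]^2 V, sym (inDeg 2 T) = inDeg 2 T →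
      ‖φ (inDeg 2 T)‖ ≤ D * √(powForm γ.form 2 T T).re) : IsHilbertSchmidt b := by
  have hR : (0 : ℝ) < 2 * D ^ 2 + 1 := by positivity
  have key : ∀ (d : ℕ) (e : Fin d → V), (∀ i j, γ.form (e i) (e j) = if i = j then 1 else 0) →
      ∑ i, ∑ j, ‖b (e i) (e j)‖ ^ 2 ≤ 2 * D ^ 2 := by
    intro d e he
    set S := ∑ i, ∑ j, ‖b (e i) (e j)‖ ^ 2 with hS
    have hS0 : 0 ≤ S := Finset.sum_nonneg fun i _ => Finset.sum_nonneg fun j _ => sq_nonneg _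
    -- On this tensor φ takes the value S, and its norm is √(2S); hence S ≤ D √(2S), which gives S ≤
    -- 2D².
    have h1 := hD _ (sym_inDeg_two_sum e (fun i j => conj (b (e i) (e j)))
      fun i j => by rw [hb])
    rw [powForm_two_sum _ e he] at h1
    have h2 : φ (inDeg 2 (∑ i, ∑ j, conj (b (e i) (e j)) • PiTensorProduct.tprod ℂ ![e i, e j])) =
        (S : ℂ) := by
      simp only [map_sum, map_smul, smul_eq_mul, hS]
      push_cast
      refine Finset.sum_congr rfl fun i _ => Finset.sum_congr rfl fun j _ => ?_
      rw [← hφ, ← Complex.normSq_eq_conj_mul_self, Complex.normSq_eq_norm_sq]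
      push_cast; rfl
    simp only [RCLike.norm_conj] at h1
    rw [h2, Complex.norm_real, Complex.ofReal_re, Real.norm_of_nonneg hS0, ← hS] at h1
    have h3 : S ^ 2 ≤ D ^ 2 * (2 * S) := by
      calc S ^ 2 ≤ (D * √(2 * S)) ^ 2 := by gcongr
        _ = _ := by rw [mul_pow, Real.sq_sqrt (by positivity)]
    by_contra hn
    push Not at hn
    nlinarith [sq_nonneg D]
  -- With R = 2D² + 1, a system e orthonormal for Rγ yields √R • e orthonormal for γ, so the sum for
  -- e is at most 2D² / R² ≤ 1. The summand 1 keeps R positive when D = 0.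
  refine ⟨PosHermForm.scale (2 * D ^ 2 + 1) hR.le γ, ?_, ?_⟩
  · have hR' : ((2 * D ^ 2 + 1 : ℝ) : ℂ) ≠ 0 := by exact_mod_cast hR.ne'
    have hleft : ∀ v w, γ.form v v = 0 → b v w = 0 := by
      intro v w hv
      have h0 := form_eq_zero_of_left γ.form γ.nonneg hv
      have h0' : ∀ w, γ.form w v = 0 := fun w => by rw [← γ.conj_symm, h0, map_zero]
      -- The bound holds on symmetric tensors only, so the pair is symmetrised; φ still gives b v w,
      -- and the tensor is null because v is.
      have h1 := hD ((2 : ℂ)⁻¹ • (PiTensorProduct.tprod ℂ ![v, w] + PiTensorProduct.tprod ℂ ![w, v]))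
        (by
          simp only [map_smul, map_add]
          change (2 : ℂ)⁻¹ • (sym (simple ![v, w]) + sym (simple ![w, v])) =
            (2 : ℂ)⁻¹ • (simple ![v, w] + simple ![w, v])
          rw [sym_pair_comm w v, sym_pair, ← two_smul ℂ, smul_smul]
          norm_num)
      have h2 : φ (inDeg 2 ((2 : ℂ)⁻¹ •
          (PiTensorProduct.tprod ℂ ![v, w] + PiTensorProduct.tprod ℂ ![w, v]))) = b v w := by
        simp only [map_smul, map_add]
        rw [← simple, ← simple, ← hφ, ← hφ, hb w v, smul_eq_mul]
        ring
      rw [h2] at h1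
      simpa [powForm_tprod, Fin.prod_univ_two, h0, h0'] using h1
    intro v w h
    rw [PosHermForm.seminorm_eq_zero, PosHermForm.seminorm_eq_zero] at h
    rcases h with h | h
    · exact hleft v w ((mul_eq_zero.mp h).resolve_left hR')
    · rw [hb]
      exact hleft w v ((mul_eq_zero.mp h).resolve_left hR')
  · intro d e he
    set r : ℝ := √(2 * D ^ 2 + 1) with hr
    have hr2 : (r : ℂ) * r = ((2 * D ^ 2 + 1 : ℝ) : ℂ) := by
      rw [← Complex.ofReal_mul, Real.mul_self_sqrt hR.le]
    have h1 := key d (fun i => (r : ℂ) • e i) fun i j => by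
      rw [← he i j]
      change _ = ((2 * D ^ 2 + 1 : ℝ) : ℂ) * _
      simp only [map_smul, map_smulₛₗ, LinearMap.smul_apply, smul_eq_mul, Complex.conj_ofReal]
      rw [← hr2]
      ring
    have h2 : ∀ i j, ‖b ((r : ℂ) • e i) ((r : ℂ) • e j)‖ ^ 2 =
        (2 * D ^ 2 + 1) ^ 2 * ‖b (e i) (e j)‖ ^ 2 := by
      intro i j
      simp only [map_smul, LinearMap.smul_apply, smul_eq_mul]
      rw [← mul_assoc, hr2, norm_mul, Complex.norm_real, Real.norm_of_nonneg hR.le, mul_pow]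
    simp only [h2, ← Finset.mul_sum] at h1
    by_contra hn
    push Not at hn
    nlinarith [sq_nonneg D]

/-- A positive continuous functional yields a bilinear form of Hilbert-Schmidt type. -/
theorem exists_bilin_of_isPositive (hc : ∀ v, c (c v) = v) (h : IsPositive c Λ ω) (hω : ω ≠ 0) :
    ∃ b : V →ₗ[ℂ] V →ₗ[ℂ] ℂ, (∀ v w, b v w = b w v) ∧ IsHermitian c b ∧
        IsHilbertSchmidt b ∧ ∀ v, 0 ≤ Λ (c v) v + b (c v) v := by
  set φ := symExtend ω.toLinearMap with hφ
  have hpos : 0 < φ 1 := h.map_one_pos hω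
  have hreal : conj (φ 1) = φ 1 := by
    rw [← h.map_star one_mem_symTensors, tensorStar_one]
  -- The normalised second moment of the functional.
  set b : V →ₗ[ℂ] V →ₗ[ℂ] ℂ := (φ 1)⁻¹ •
    ((LinearMap.mul ℂ (TensorAlg V)).compl₁₂ inclV inclV).compr₂ φ with hb
  have b_apply : ∀ v w, b v w = (φ 1)⁻¹ * φ (simple ![v, w]) := by
    intro v w
    rw [← vpow_one_mul, ← inclV_apply, ← inclV_apply]
    rfl
  have φ_sym : ∀ X, φ (sym X) = φ X := symExtend_sym _
  have b_symm : ∀ v w, b v w = b w v := by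
    intro v w
    rw [b_apply, b_apply, ← φ_sym (simple ![v, w]), sym_pair_comm, φ_sym]
  refine ⟨b, b_symm, ?_, ?_, ?_⟩
  · intro v w
    rw [b_apply, b_apply, map_mul, map_inv₀, hreal, ← φ_sym (simple ![c w, c v]),
      ← h.map_star (LinearMap.mem_range_self sym _), ← sym_tensorStar, φ_sym, tensorStar_pair]
    change _ = (φ 1)⁻¹ * φ (simple ![c (c v), c (c w)])
    rw [hc, hc]
  · obtain ⟨γ, C, hC, hbd⟩ := exists_tensorSeminorm_bound ω
    refine isHilbertSchmidt_of_bound b b_symm ((φ 1)⁻¹ • φ) b_apply γ (‖(φ 1)⁻¹‖ * C) fun T hT => ?_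
    have h1 := hbd ⟨inDeg 2 T, inDeg 2 T, hT⟩
    rw [tensorSeminorm_apply, tensorForm_inDeg] at h1
    rw [LinearMap.smul_apply, smul_eq_mul, norm_mul, mul_assoc]
    refine mul_le_mul_of_nonneg_left ?_ (norm_nonneg _)
    rwa [hφ, symExtend_of_mem _ ⟨inDeg 2 T, hT⟩]
  · intro v
    -- Positivity on the vector v reads ω(v̄ ∨ v) + Λ(v̄, v) ω(1) ≥ 0; dividing by ω(1) gives the
    -- claim.
    have h1 := (isPositive_iff c Λ ω).mp h _ (vpow_mem v 1)
    rw [tensorStar_vpow, mulStar_vpow_one, map_add, symExtend_sym, vpow_one_mul, map_smul,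
      smul_eq_mul, ← hφ] at h1
    have h2 := mul_nonneg (inv_nonneg.mpr hpos.le) h1
    rw [b_apply]
    convert h2 using 1
    have := hpos.ne'
    change Λ (c v) v + _ * φ (simple ![c v, v]) = _ * (φ (simple ![c v, v]) + Λ (c v) v * φ 1)
    field_simp
    ring

end Positive

end

noncomputable section

/-! ### Products of copies of b and ρ, dominated by tensor powers -/

section PairForm

variable {V : Type*} [AddCommGroup V] [Module ℂ V]

/-- The multilinear form `b ⊗ ⋯ ⊗ b ⊗ ρ ⊗ ⋯ ⊗ ρ` in `n` variables with `j` factors `b`, which is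
zero if `n < 2 j`. -/
def pairForm (b : V →ₗ[ℂ] V →ₗ[ℂ] ℂ) (ρ : V →ₗ[ℂ] ℂ) :
    ∀ _ n : ℕ, MultilinearMap ℂ (fun _ : Fin n => V) ℂ
  | 0, n => (MultilinearMap.mkPiAlgebra ℂ (Fin n) ℂ).compLinearMap fun _ => ρ
  | _ + 1, 0 => 0
  | _ + 1, 1 => 0
  | j + 1, n + 2 => LinearMap.uncurryLeft
      { toFun := fun v => LinearMap.uncurryLeft ((b v).smulRight (pairForm b ρ j n))
        map_add' := fun v w => by ext; simp [add_mul]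
        map_smul' := fun r v => by ext; simp [mul_assoc] }

variable (b : V →ₗ[ℂ] V →ₗ[ℂ] ℂ) (ρ : V →ₗ[ℂ] ℂ)

theorem pairForm_zero (n : ℕ) (x : Fin n → V) : pairForm b ρ 0 n x = ∏ i, ρ (x i) := by
  simp [pairForm]

theorem pairForm_succ (j n : ℕ) (x : Fin (n + 2) → V) :
    pairForm b ρ (j + 1) (n + 2) x = b (x 0) (x 1) * pairForm b ρ j n fun i => x i.succ.succ := by
  simp only [pairForm]
  rfl

theorem pairForm_const (v : V) (p j : ℕ) :
    pairForm b ρ j (p + 2 * j) (fun _ => v) = b v v ^ j * ρ v ^ p := by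
  induction j with
  | zero => rw [pairForm_zero]; simp
  | succ j ih =>
    rw [show p + 2 * (j + 1) = p + 2 * j + 2 from rfl, pairForm_succ, ih]
    ring

theorem rankOne_posSemidef {ι : Type*} (f : ι → ℂ) :
    (Matrix.of fun x y : ι => conj (f x) * f y).PosSemidef := by
  refine ⟨by ext x y; simp [mul_comm], fun a => ?_⟩
  have e : (a.sum fun p r => a.sum fun q t => star r *
      (Matrix.of fun x y : ι => conj (f x) * f y) p q * t) =
      star (a.sum fun p r => r * f p) * a.sum fun p r => r * f p := by
    simp only [Finsupp.sum, star_sum, Finset.sum_mul_sum, star_mul, Matrix.of_apply,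
      starRingEnd_apply]
    refine Finset.sum_congr rfl fun p _ => Finset.sum_congr rfl fun q _ => ?_
    ring
  rw [e]
  exact star_mul_self_nonneg _

/-- If `B` dominates `ρ` and its tensor square dominates `b`, then the tensor powers of `B` dominate
the forms `b ⊗ ⋯ ⊗ b ⊗ ρ ⊗ ⋯ ⊗ ρ`. -/
theorem pairForm_posSemidef (B : V →ₗ⋆[ℂ] V →ₗ[ℂ] ℂ) (hsymm : ∀ v w, conj (B v w) = B w v)
    (hpos : ∀ v, 0 ≤ B v v) (hρ : ∀ v, conj (ρ v) * ρ v ≤ B v v)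
    (hb : (Matrix.of fun x y : V × V => B x.1 y.1 * B x.2 y.2 -
      conj (b x.1 x.2) * b y.1 y.2).PosSemidef) :
    ∀ j n : ℕ, (Matrix.of fun x y : Fin n → V => (∏ m, B (x m) (y m)) -
      conj (pairForm b ρ j n x) * pairForm b ρ j n y).PosSemidef
  | 0, n => by
    have h := prodForm_sub_posSemidef (LinearMap.mk₂'ₛₗ (starRingEnd ℂ) (RingHom.id ℂ)
      (fun v w => conj (ρ v) * ρ w) (by intros; simp [add_mul]) (by intros; simp [mul_assoc])
      (by intros; simp [mul_add]) (by intros; simp [mul_left_comm])) B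
      (by intros; simp [mul_comm]) (fun v => star_mul_self_nonneg (ρ v)) hsymm hρ
      (k := n) Finset.univ
    convert h using 1
    ext x y
    simp [pairForm_zero, Finset.prod_mul_distrib]
  | j + 1, 0 => by
    have h := prodForm_posSemidef B hsymm hpos (k := 0) Finset.univ
    convert h using 1
    ext x y
    simp [pairForm]
  | j + 1, 1 => by
    have h := prodForm_posSemidef B hsymm hpos (k := 1) Finset.univ
    convert h using 1
    ext x y
    simp [pairForm]
  | j + 1, n + 2 => by
    have ih := (pairForm_posSemidef B hsymm hpos hρ hb j n).submatrix
      fun (x : Fin (n + 2) → V) i => x i.succ.succ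
    have h1 := hb.submatrix fun x : Fin (n + 2) → V => (x 0, x 1)
    have h2 := (prodForm_posSemidef B hsymm hpos (k := n) Finset.univ).submatrix
      fun (x : Fin (n + 2) → V) i => x i.succ.succ
    have h3 := rankOne_posSemidef fun x : Fin (n + 2) → V => b (x 0) (x 1)
    -- The first two variables carry the comparison of B ⊗ B with b, the remaining ones the
    -- induction hypothesis.
    have := hadamard_sub_posSemidef
      (A := Matrix.of fun x y : Fin (n + 2) → V => B (x 0) (y 0) * B (x 1) (y 1))
      (A' := Matrix.of fun x y : Fin (n + 2) → V => conj (b (x 0) (x 1)) * b (y 0) (y 1))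
      (C' := Matrix.of fun x y : Fin (n + 2) → V =>
        conj (pairForm b ρ j n fun i => x i.succ.succ) * pairForm b ρ j n fun i => y i.succ.succ)
      (by convert h1 using 1; ext; simp) h2 h3
      (by convert ih using 1; ext; simp)
    convert this using 1
    ext x y
    simp only [pairForm_succ, Fin.prod_univ_succ, Matrix.of_apply, Matrix.sub_apply,
      Matrix.hadamard_apply, Matrix.submatrix_apply, map_mul, Fin.succ_zero_eq_one]
    ring

end PairForm

/-! ### Orthonormal systems and boundedness of Hilbert–Schmidt forms -/

section HilbertSchmidt

variable {V : Type*} [AddCommGroup V] [Module ℂ V]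

/-- Every finite set lies in the span of an orthonormal system, up to vectors of norm zero. -/
theorem exists_orthonormal_residual (B : V →ₗ⋆[ℂ] V →ₗ[ℂ] ℂ)
    (hsymm : ∀ v w, conj (B v w) = B w v) (hpos : ∀ v, 0 ≤ B v v) (s : Finset V) :
    ∃ (d : ℕ) (e : Fin d → V), (∀ i j, B (e i) (e j) = if i = j then 1 else 0) ∧
      ∀ x ∈ s, B (x - ∑ i, B (e i) x • e i) (x - ∑ i, B (e i) x • e i) = 0 := by
  classical
  induction s using Finset.induction_on with
  | empty => exact ⟨0, Fin.elim0, fun i => i.elim0, by simp⟩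
  | insert a s _ ih =>
    obtain ⟨d, e, he, hs⟩ := ih
    set r := a - ∑ i, B (e i) a • e i with hr
    have hort : ∀ i, B (e i) r = 0 := by
      intro i
      simp [hr, he]
    have hort' : ∀ i, B r (e i) = 0 := fun i => by rw [← hsymm, hort, map_zero]
    -- Gram–Schmidt for a semi-definite form: a null residual is accepted as it is, any other one is
    -- normalised and appended.
    by_cases h0 : B r r = 0
    · refine ⟨d, e, he, fun x hx => ?_⟩
      rcases Finset.mem_insert.mp hx with rfl | hx
      · exact h0
      · exact hs x hx
    · have hre := form_self_eq_re B hpos r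
      have hre0 : 0 < (B r r).re := lt_of_le_of_ne (Complex.nonneg_iff.mp (hpos r)).1 fun h =>
        h0 (by rw [hre, ← h, Complex.ofReal_zero])
      obtain ⟨l, hlc, hl2⟩ : ∃ l : ℂ, conj l = l ∧ l * l * B r r = 1 := by
        refine ⟨((√(B r r).re)⁻¹ : ℝ), Complex.conj_ofReal _, ?_⟩
        rw [hre, ← Complex.ofReal_mul, ← Complex.ofReal_mul, Complex.ofReal_re, ← mul_inv,
          Real.mul_self_sqrt hre0.le, inv_mul_cancel₀ hre0.ne', Complex.ofReal_one]
      refine ⟨d + 1, Fin.snoc e (l • r), ?_, ?_⟩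
      · intro i j
        refine Fin.lastCases ?_ (fun i => ?_) i <;> refine Fin.lastCases ?_ (fun j => ?_) j
        · simp [← mul_assoc, hl2, hlc]
        · simp [hort', (Fin.castSucc_lt_last j).ne']
        · simp [hort, (Fin.castSucc_lt_last i).ne]
        · simp [he]
      · intro x hx
        simp only [Fin.sum_univ_castSucc, Fin.snoc_castSucc, Fin.snoc_last]
        rcases Finset.mem_insert.mp hx with rfl | hx
        · have hx' : B r x = B r r := by
            have hx0 : x = r + ∑ i, B (e i) x • e i := by rw [hr]; abel
            refine (congrArg (B r) hx0).trans ?_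
            simp [hort']
          have : x - (∑ i, B (e i) x • e i + B (l • r) x • l • r) = 0 := by
            rw [← sub_sub, ← hr, map_smulₛₗ, LinearMap.smul_apply, hx', smul_smul, smul_eq_mul,
              hlc, mul_right_comm, hl2, one_smul, sub_self]
          rw [this, map_zero]
        -- An earlier x differs from its projection by a null vector, and r is orthogonal to every e
        -- i, so the new coefficient is zero.
        · have h1 : B r x = 0 := by
            have h2 := form_eq_zero_of_left B hpos (hs x hx) r
            rw [← hsymm, map_eq_zero, map_sub, map_sum] at h2
            simpa [hort'] using h2
          have h3 : B (l • r) x = 0 := by simp [h1]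
          rw [h3, zero_smul, add_zero]
          exact hs x hx

/-- Bilinear forms of Hilbert-Schmidt type are bounded on the Hilbert tensor product. -/
theorem hilbertSchmidt_posSemidef (b : V →ₗ[ℂ] V →ₗ[ℂ] ℂ) (B : V →ₗ⋆[ℂ] V →ₗ[ℂ] ℂ)
    (hsymm : ∀ v w, conj (B v w) = B w v) (hpos : ∀ v, 0 ≤ B v v)
    (hb0 : ∀ v w, B v v = 0 ∨ B w w = 0 → b v w = 0)
    (hb : ∀ (d : ℕ) (e : Fin d → V), (∀ i j, B (e i) (e j) = if i = j then 1 else 0) →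
      ∑ i, ∑ j, ‖b (e i) (e j)‖ ^ 2 ≤ 1) :
    (Matrix.of fun x y : V × V => B x.1 y.1 * B x.2 y.2 -
      conj (b x.1 x.2) * b y.1 y.2).PosSemidef := by
  classical
  refine ⟨by ext x y; simp [hsymm, mul_comm], fun a => ?_⟩
  -- The coefficients a have finite support, so one finite orthonormal system handles all vectors
  -- that occur.
  obtain ⟨d, e, he, hs⟩ := exists_orthonormal_residual B hsymm hpos
    (a.support.image Prod.fst ∪ a.support.image Prod.snd)
  have hs1 : ∀ p ∈ a.support, _ := fun p hp =>
    hs p.1 (Finset.mem_union_left _ (Finset.mem_image_of_mem _ hp))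
  have hs2 : ∀ p ∈ a.support, _ := fun p hp =>
    hs p.2 (Finset.mem_union_right _ (Finset.mem_image_of_mem _ hp))
  have hB : ∀ x y : V, B (x - ∑ i, B (e i) x • e i) (x - ∑ i, B (e i) x • e i) = 0 →
      B x y = ∑ i, conj (B (e i) x) * B (e i) y := by
    intro x y hx
    have h := form_eq_zero_of_left B hpos hx y
    rw [map_sub, LinearMap.sub_apply, sub_eq_zero] at h
    rw [h]
    simp
  have hbexp : ∀ x y : V, B (x - ∑ i, B (e i) x • e i) (x - ∑ i, B (e i) x • e i) = 0 →
      B (y - ∑ i, B (e i) y • e i) (y - ∑ i, B (e i) y • e i) = 0 →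
      b x y = ∑ i, ∑ j, B (e i) x * B (e j) y * b (e i) (e j) := by
    intro x y hx hy
    have h1 := hb0 _ y (Or.inl hx)
    rw [map_sub, LinearMap.sub_apply, sub_eq_zero] at h1
    have h2 : ∀ v, b v y = ∑ j, B (e j) y * b v (e j) := by
      intro v
      have h := hb0 v _ (Or.inr hy)
      rw [map_sub, sub_eq_zero] at h
      rw [h]
      simp
    rw [h1]
    simp only [map_sum, map_smul, LinearMap.sum_apply, LinearMap.smul_apply, smul_eq_mul]
    refine Finset.sum_congr rfl fun i _ => ?_
    rw [h2, Finset.mul_sum]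
    refine Finset.sum_congr rfl fun j _ => ?_
    ring
  -- T is the coordinate matrix of ∑ a p • (p.1 ⊗ p.2). The quadratic form becomes ‖T‖² - |∑ T i j
  -- b(e_i, e_j)|², which is non-negative by Cauchy–Schwarz and the bound on b.
  set T : Fin d → Fin d → ℂ := fun i j => ∑ p ∈ a.support, a p * B (e i) p.1 * B (e j) p.2 with hT
  have e1 : (∑ p ∈ a.support, ∑ q ∈ a.support, star (a p) * (B p.1 q.1 * B p.2 q.2) * a q) =
      ((∑ i, ∑ j, ‖T i j‖ ^ 2 : ℝ) : ℂ) := by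
    have : ∀ i j, ((‖T i j‖ ^ 2 : ℝ) : ℂ) = ∑ p ∈ a.support, ∑ q ∈ a.support,
        star (a p) * ((conj (B (e i) p.1) * B (e i) q.1) * (conj (B (e j) p.2) * B (e j) q.2)) *
          a q := by
      intro i j
      rw [← Complex.normSq_eq_norm_sq, Complex.normSq_eq_conj_mul_self, hT]
      simp only [map_sum, map_mul, Finset.sum_mul_sum]
      refine Finset.sum_congr rfl fun p _ => Finset.sum_congr rfl fun q _ => ?_
      rw [starRingEnd_apply]
      simp only [starRingEnd_apply]
      ring
    push_cast at this ⊢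
    simp only [this]
    have h1 : ∀ p ∈ a.support, ∀ q ∈ a.support, star (a p) * (B p.1 q.1 * B p.2 q.2) * a q =
        ∑ i, ∑ j, star (a p) * ((conj (B (e i) p.1) * B (e i) q.1) *
          (conj (B (e j) p.2) * B (e j) q.2)) * a q := by
      intro p hp q _
      rw [hB p.1 q.1 (hs1 p hp), hB p.2 q.2 (hs2 p hp), Finset.sum_mul_sum]
      simp only [Finset.mul_sum, Finset.sum_mul]
    rw [Finset.sum_congr rfl fun p hp => Finset.sum_congr rfl fun q hq => h1 p hp q hq]
    rw [Finset.sum_congr rfl fun p _ => Finset.sum_comm]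
    rw [Finset.sum_comm]
    refine Finset.sum_congr rfl fun i _ => ?_
    rw [Finset.sum_congr rfl fun p _ => Finset.sum_comm]
    rw [Finset.sum_comm]
  set S : ℂ := ∑ p ∈ a.support, a p * b p.1 p.2 with hS
  have e2 : S = ∑ i, ∑ j, T i j * b (e i) (e j) := by
    rw [hS, Finset.sum_congr rfl fun p hp => by rw [hbexp p.1 p.2 (hs1 p hp) (hs2 p hp)]]
    simp only [hT, Finset.mul_sum, Finset.sum_mul]
    rw [Finset.sum_comm]
    refine Finset.sum_congr rfl fun i _ => ?_
    rw [Finset.sum_comm]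
    refine Finset.sum_congr rfl fun j _ => Finset.sum_congr rfl fun p _ => ?_
    ring
  have e3 : ‖S‖ ^ 2 ≤ ∑ i, ∑ j, ‖T i j‖ ^ 2 := by
    have h1 : ‖S‖ ≤ ∑ p : Fin d × Fin d, ‖T p.1 p.2‖ * ‖b (e p.1) (e p.2)‖ := by
      rw [e2, ← Fintype.sum_prod_type' (f := fun i j => T i j * b (e i) (e j))]
      refine (norm_sum_le _ _).trans (le_of_eq ?_)
      exact Finset.sum_congr rfl fun p _ => norm_mul _ _
    have h2 := Finset.sum_mul_sq_le_sq_mul_sq Finset.univ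
      (fun p : Fin d × Fin d => ‖T p.1 p.2‖) (fun p => ‖b (e p.1) (e p.2)‖)
    rw [Fintype.sum_prod_type' (f := fun i j => ‖T i j‖ ^ 2),
      Fintype.sum_prod_type' (f := fun i j => ‖b (e i) (e j)‖ ^ 2)] at h2
    calc ‖S‖ ^ 2 ≤ _ := by gcongr
      _ ≤ _ := h2
      _ ≤ _ := mul_le_of_le_one_right
        (Finset.sum_nonneg fun i _ => Finset.sum_nonneg fun j _ => sq_nonneg _) (hb d e he)
  have e4 : (a.sum fun p r => a.sum fun q t => star r * (Matrix.of fun x y : V × V =>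
      B x.1 y.1 * B x.2 y.2 - conj (b x.1 x.2) * b y.1 y.2) p q * t) =
      ((∑ i, ∑ j, ‖T i j‖ ^ 2 - ‖S‖ ^ 2 : ℝ) : ℂ) := by
    rw [Complex.ofReal_sub, ← e1, ← Complex.normSq_eq_norm_sq S, Complex.normSq_eq_conj_mul_self,
      hS, map_sum, Finset.sum_mul_sum]
    simp only [Finsupp.sum, ← Finset.sum_sub_distrib]
    refine Finset.sum_congr rfl fun p _ => Finset.sum_congr rfl fun q _ => ?_
    simp only [Matrix.of_apply, map_mul, starRingEnd_apply]
    ring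
  rw [e4]
  exact_mod_cast sub_nonneg.mpr e3

end HilbertSchmidt

end

/-! ### Power series of Gaussian exponentials -/

noncomputable section

open PowerSeries in
/-- The power series of `exp (c z ^ 2)`. -/
def expSq (c : ℂ) : PowerSeries ℂ := expand 2 two_ne_zero (rescale c (exp ℂ))

theorem coeff_expSq (c : ℂ) (n : ℕ) :
    PowerSeries.coeff n (expSq c) = if 2 ∣ n then c ^ (n / 2) * ((n / 2).factorial : ℂ)⁻¹ else 0 := by
  simp [expSq, PowerSeries.coeff_expand, PowerSeries.coeff_rescale, PowerSeries.coeff_exp]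

theorem expSq_mul (c d : ℂ) : expSq c * expSq d = expSq (c + d) := by
  rw [expSq, expSq, ← map_mul, PowerSeries.exp_mul_exp_eq_exp_add]; rfl

/-- Terms with 2r > n do not contribute, so any N > n will do; the freedom lets several expansions
share one range. -/
theorem coeff_expSq_mul (c : ℂ) (H : PowerSeries ℂ) {n N : ℕ} (hN : n < N) :
    PowerSeries.coeff n (expSq c * H) = ∑ r ∈ Finset.range N, c ^ r * (r.factorial : ℂ)⁻¹ *
      PowerSeries.coeff n (PowerSeries.X ^ (2 * r) * H) := by
  rw [PowerSeries.coeff_mul, Finset.Nat.sum_antidiagonal_eq_sum_range_succ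
    (fun i j => PowerSeries.coeff i (expSq c) * PowerSeries.coeff j H)]
  simp only [coeff_expSq, PowerSeries.coeff_X_pow_mul', mul_ite, mul_zero, ite_mul, zero_mul]
  rw [← Finset.sum_filter, ← Finset.sum_filter]
  symm
  refine Finset.sum_nbij' (fun r => 2 * r) (fun i => i / 2) ?_ ?_ ?_ ?_ ?_
  · intro r hr; simp at hr ⊢; omega
  · intro r hr; simp at hr ⊢; omega
  · intro r hr; simp
  · intro r hr; simp at hr ⊢; omega
  · intro r hr; simp

/-- The power series of `exp (a z + b z ^ 2 / 2)`. -/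
def gaussSeries (a b : ℂ) : PowerSeries ℂ :=
  PowerSeries.rescale a (PowerSeries.exp ℂ) * expSq (b / 2)

theorem gaussSeries_mul (a b a' b' : ℂ) :
    gaussSeries a b * gaussSeries a' b' = gaussSeries (a + a') (b + b') := by
  rw [gaussSeries, gaussSeries, mul_mul_mul_comm, PowerSeries.exp_mul_exp_eq_exp_add, expSq_mul,
    ← add_div]; rfl

theorem expSq_mul_gaussSeries (c a b : ℂ) :
    expSq c * gaussSeries a b = gaussSeries a (2 * c + b) := by
  rw [gaussSeries, gaussSeries, mul_left_comm, expSq_mul]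
  congr 2
  ring

theorem rescale_gaussSeries (z a b : ℂ) :
    PowerSeries.rescale z (gaussSeries a b) = gaussSeries (z * a) (z ^ 2 * b) := by
  rw [gaussSeries, gaussSeries, map_mul]
  congr 1
  · ext n
    simp only [PowerSeries.coeff_rescale, mul_pow, mul_assoc]
  · ext n
    rw [PowerSeries.coeff_rescale, coeff_expSq, coeff_expSq]
    split_ifs with h
    · obtain ⟨m, rfl⟩ := h
      simp only [Nat.mul_div_cancel_left _ two_pos]
      rw [mul_div_assoc, mul_pow, pow_mul, mul_assoc]
    · simp

theorem map_conj_coeff_gaussSeries (a b : ℂ) (n : ℕ) :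
    conj (PowerSeries.coeff n (gaussSeries a b)) =
      PowerSeries.coeff n (gaussSeries (conj a) (conj b)) := by
  simp only [gaussSeries, PowerSeries.coeff_mul, map_sum, map_mul, coeff_expSq,
    PowerSeries.coeff_rescale, PowerSeries.coeff_exp]
  refine Finset.sum_congr rfl fun p _ => ?_
  congr 1
  · simp
  · split_ifs <;> simp [Complex.conj_ofNat]

/-- The coefficient of `z ^ p w ^ q` in `G (z) H (w) exp (c z w)`, as a sum of `N` terms. -/
def mixCoeff (G H : PowerSeries ℂ) (c : ℂ) (N p q : ℕ) : ℂ :=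
  ∑ r ∈ Finset.range N, c ^ r * (r.factorial : ℂ)⁻¹ *
    (PowerSeries.coeff p (PowerSeries.X ^ r * G) * PowerSeries.coeff q (PowerSeries.X ^ r * H))

/-- Restriction of G(x) H(y) exp(c x y) to the line (x, y) = (z u, u) gives G(z u) H(u) exp(z c u²),
whose coefficient of uⁿ collects all bidegrees on the antidiagonal. -/
theorem sum_pow_mul_mixCoeff (G H : PowerSeries ℂ) (c z : ℂ) {n N : ℕ} (hN : n < N) :
    ∑ p ∈ Finset.HasAntidiagonal.antidiagonal n, z ^ p.1 * mixCoeff G H c N p.1 p.2 =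
      PowerSeries.coeff n (expSq (z * c) * (PowerSeries.rescale z G * H)) := by
  rw [coeff_expSq_mul _ _ hN]
  simp only [mixCoeff, Finset.mul_sum]
  rw [Finset.sum_comm]
  refine Finset.sum_congr rfl fun r _ => ?_
  have h : PowerSeries.C (z ^ r) * (PowerSeries.X ^ (2 * r) * (PowerSeries.rescale z G * H)) =
      PowerSeries.rescale z (PowerSeries.X ^ r * G) * (PowerSeries.X ^ r * H) := by
    rw [map_mul, map_pow, map_pow, PowerSeries.rescale_X, mul_pow, two_mul, pow_add]
    ring
  have h2 : z ^ r * PowerSeries.coeff n (PowerSeries.X ^ (2 * r) * (PowerSeries.rescale z G * H)) =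
      ∑ p ∈ Finset.HasAntidiagonal.antidiagonal n, z ^ p.1 *
        (PowerSeries.coeff p.1 (PowerSeries.X ^ r * G) *
          PowerSeries.coeff p.2 (PowerSeries.X ^ r * H)) := by
    rw [← PowerSeries.coeff_C_mul, h, PowerSeries.coeff_mul]
    refine Finset.sum_congr rfl fun p _ => ?_
    rw [PowerSeries.coeff_rescale, mul_assoc]
  have e : ∀ a y : ℂ, (z * c) ^ r * a * y = c ^ r * a * (z ^ r * y) := by intros; ring
  rw [e, h2, Finset.mul_sum]
  refine Finset.sum_congr rfl fun p _ => ?_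
  ring

/-- A Cauchy product of truncated sums: pairs with t + r ≥ N are killed by u. -/
theorem sum_range_sum_range {N : ℕ} (f g u : ℕ → ℂ) (hu : ∀ s, N ≤ s → u s = 0) :
    ∑ t ∈ Finset.range N, ∑ r ∈ Finset.range N, f t * g r * u (t + r) =
      ∑ s ∈ Finset.range N,
        (∑ p ∈ Finset.HasAntidiagonal.antidiagonal s, f p.1 * g p.2) * u s := by
  simp only [Finset.sum_mul]
  rw [← Finset.sum_product' _ _ fun t r => f t * g r * u (t + r), Finset.sum_sigma']
  symm
  refine Finset.sum_of_injOn (fun x => x.2) ?_ ?_ ?_ ?_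
  · rintro ⟨s, p⟩ h ⟨s', p'⟩ h' (e : p = p')
    simp at h h'
    subst e
    obtain rfl : s = s' := by omega
    rfl
  · rintro ⟨s, p⟩ h
    simp at h ⊢
    omega
  · rintro ⟨t, r⟩ h hn
    rw [hu, mul_zero]
    by_contra hlt
    push Not at hlt
    refine hn ⟨⟨t + r, (t, r)⟩, ?_, rfl⟩
    simpa using hlt
  · rintro ⟨s, p⟩ h
    simp at h ⊢
    exact Or.inl (by rw [h.2])

theorem sum_antidiagonal_exp (a b : ℂ) (s : ℕ) :
    ∑ p ∈ Finset.HasAntidiagonal.antidiagonal s, (a ^ p.1 * (p.1.factorial : ℂ)⁻¹) *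
      (b ^ p.2 * (p.2.factorial : ℂ)⁻¹) = (a + b) ^ s * (s.factorial : ℂ)⁻¹ := by
  have h := congrArg (PowerSeries.coeff s) (PowerSeries.exp_mul_exp_eq_exp_add a b)
  rw [PowerSeries.coeff_mul] at h
  simpa [PowerSeries.coeff_rescale, PowerSeries.coeff_exp] using h

/-- Composing the coefficient formulas for `exp (c z w)` and `exp (d z w)`. -/
theorem sum_mixCoeff (G H : PowerSeries ℂ) (c d : ℂ) {k l N : ℕ} (hN : k < N) :
    ∑ t ∈ Finset.range N, d ^ t * (t.factorial : ℂ)⁻¹ *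
      (if t ≤ k ∧ t ≤ l then mixCoeff G H c N (k - t) (l - t) else 0) =
        mixCoeff G H (d + c) N k l := by
  -- The coefficient of z^k w^l in (z w)^s G(z) H(w); the claim is then exp(d z w) exp(c z w) =
  -- exp((d + c) z w).
  set u : ℕ → ℂ := fun s => PowerSeries.coeff k (PowerSeries.X ^ s * G) *
    PowerSeries.coeff l (PowerSeries.X ^ s * H) with hu
  have hu0 : ∀ s, N ≤ s → u s = 0 := by
    intro s hs
    simp only [hu]
    rw [PowerSeries.coeff_X_pow_mul', if_neg (by omega), zero_mul]
  have hu1 : ∀ t r, u (t + r) = if t ≤ k ∧ t ≤ l then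
      PowerSeries.coeff (k - t) (PowerSeries.X ^ r * G) *
        PowerSeries.coeff (l - t) (PowerSeries.X ^ r * H) else 0 := by
    intro t r
    simp only [hu, pow_add, mul_assoc]
    rw [PowerSeries.coeff_X_pow_mul', PowerSeries.coeff_X_pow_mul' _ _ l]
    by_cases h1 : t ≤ k <;> by_cases h2 : t ≤ l <;> simp [h1, h2]
  have h := sum_range_sum_range (N := N) (fun t => d ^ t * (t.factorial : ℂ)⁻¹)
    (fun r => c ^ r * (r.factorial : ℂ)⁻¹) u hu0
  simp only [sum_antidiagonal_exp] at h
  change _ = ∑ s ∈ Finset.range N, (d + c) ^ s * (s.factorial : ℂ)⁻¹ * u s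
  rw [← h]
  refine Finset.sum_congr rfl fun t _ => ?_
  simp only [hu1, mixCoeff]
  split_ifs
  · rw [Finset.mul_sum]
    exact Finset.sum_congr rfl fun r _ => by ring
  · simp

/-- On an antidiagonal the exponent `p.1` determines p, so comparing polynomial coefficients in z
isolates each term. This is how mixed values are recovered from pure powers. -/
theorem eq_of_sum_antidiagonal_pow_mul {n : ℕ} {f g : ℕ × ℕ → ℂ}
    (h : ∀ z : ℂ, ∑ p ∈ Finset.HasAntidiagonal.antidiagonal n, z ^ p.1 * f p =
      ∑ p ∈ Finset.HasAntidiagonal.antidiagonal n, z ^ p.1 * g p) {p : ℕ × ℕ}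
    (hp : p ∈ Finset.HasAntidiagonal.antidiagonal n) : f p = g p := by
  have key : ∑ p ∈ Finset.HasAntidiagonal.antidiagonal n, Polynomial.monomial p.1 (f p) =
      ∑ p ∈ Finset.HasAntidiagonal.antidiagonal n, Polynomial.monomial p.1 (g p) := by
    refine Polynomial.funext fun z => ?_
    simp only [Polynomial.eval_finsetSum, Polynomial.eval_monomial]
    simpa only [mul_comm] using h z
  have hc : ∀ f : ℕ × ℕ → ℂ, (∑ p ∈ Finset.HasAntidiagonal.antidiagonal n,
      Polynomial.monomial p.1 (f p)).coeff p.1 = f p := by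
    intro f
    rw [Polynomial.finsetSum_coeff, Finset.sum_eq_single_of_mem p hp]
    · simp
    · intro q hq hne
      rw [Polynomial.coeff_monomial, if_neg]
      intro e
      rw [Finset.HasAntidiagonal.mem_antidiagonal] at hp hq
      exact hne (Prod.ext e (by omega))
  rw [← hc f, key, hc g]

end

noncomputable section

/-! ### Gaussian functionals: values and positivity -/

section Gauss

variable {V : Type*} [AddCommGroup V] [Module ℂ V]

/-- The component of degree `n` of the Gaussian functional. -/
def gaussPow (b : V →ₗ[ℂ] V →ₗ[ℂ] ℂ) (ρ : V →ₗ[ℂ] ℂ) (n : ℕ) : ⨂[ℂ]^n V →ₗ[ℂ] ℂ :=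
  ∑ p ∈ Finset.HasAntidiagonal.antidiagonal n,
    ((n.factorial : ℂ) * (p.1.factorial : ℂ)⁻¹ * PowerSeries.coeff p.2 (expSq 2⁻¹)) •
      PiTensorProduct.lift (pairForm b ρ (p.2 / 2) n)

/-- The Gaussian functional with mean `ρ` and covariance `b`. -/
def gaussFunctional (b : V →ₗ[ℂ] V →ₗ[ℂ] ℂ) (ρ : V →ₗ[ℂ] ℂ) : TensorAlg V →ₗ[ℂ] ℂ :=
  DirectSum.toModule ℂ ℕ ℂ (gaussPow b ρ)

variable (b : V →ₗ[ℂ] V →ₗ[ℂ] ℂ) (ρ : V →ₗ[ℂ] ℂ)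

theorem gaussFunctional_inDeg {n : ℕ} (T : ⨂[ℂ]^n V) :
    gaussFunctional b ρ (inDeg n T) = gaussPow b ρ n T :=
  DirectSum.toModule_lof (M := fun k => ⨂[ℂ]^k V) ℂ n T

theorem gaussFunctional_vpow (v : V) (n : ℕ) :
    gaussFunctional b ρ (vpow v n) =
      n.factorial * PowerSeries.coeff n (gaussSeries (ρ v) (b v v)) := by
  rw [vpow, simple, gaussFunctional_inDeg, gaussPow, gaussSeries, PowerSeries.coeff_mul,
    LinearMap.sum_apply, Finset.mul_sum]
  refine Finset.sum_congr rfl fun p hp => ?_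
  rw [Finset.HasAntidiagonal.mem_antidiagonal] at hp
  rw [LinearMap.smul_apply, PiTensorProduct.lift.tprod, coeff_expSq, coeff_expSq,
    PowerSeries.coeff_rescale, PowerSeries.coeff_exp]
  split_ifs with h
  · obtain ⟨j, hj⟩ := h
    obtain ⟨p, q⟩ := p
    dsimp only at hj hp ⊢
    subst hj
    subst hp
    rw [Nat.mul_div_cancel_left _ two_pos, pairForm_const]
    simp [div_eq_mul_inv, mul_pow]
    ring
  · simp

/-- Polarisation: the pure moment of z • v + w is a polynomial in z, and the cross term 2 z b(v, w)
of the quadratic exponent produces the factor exp(b(v, w) x y). -/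
theorem gaussFunctional_sym_mul (hb : ∀ v w, b v w = b w v) (v w : V) {p q N : ℕ}
    (hN : p + q < N) :
    gaussFunctional b ρ (sym (vpow v p * vpow w q)) = p.factorial * q.factorial *
      mixCoeff (gaussSeries (ρ v) (b v v)) (gaussSeries (ρ w) (b w w)) (b v w) N p q := by
  have h := eq_of_sum_antidiagonal_pow_mul (n := p + q)
    (f := fun p => ((p.1 + p.2).choose p.1 : ℂ) *
      gaussFunctional b ρ (sym (vpow v p.1 * vpow w p.2)))
    (g := fun x => ((p + q).factorial : ℂ) * mixCoeff (gaussSeries (ρ v) (b v v))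
      (gaussSeries (ρ w) (b w w)) (b v w) N x.1 x.2) (p := (p, q)) ?_ (by simp)
  · have h1 : (((p + q).choose p : ℕ) : ℂ) * p.factorial * q.factorial = (p + q).factorial := by
      rw [Nat.choose_symm_add]
      exact_mod_cast Nat.add_choose_mul_factorial_mul_factorial p q
    have h2 : (((p + q).choose p : ℕ) : ℂ) ≠ 0 := by
      exact_mod_cast (Nat.choose_pos (Nat.le_add_right p q)).ne'
    dsimp only at h
    rw [← h1] at h
    refine mul_left_cancel₀ h2 (h.trans ?_)
    ring
  · intro z
    have h1 := gaussFunctional_vpow b ρ (z • v + w) (p + q)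
    rw [vpow_smul_add, map_sum] at h1
    have h2 : gaussSeries (ρ (z • v + w)) (b (z • v + w) (z • v + w)) =
        expSq (z * b v w) * (PowerSeries.rescale z (gaussSeries (ρ v) (b v v)) *
          gaussSeries (ρ w) (b w w)) := by
      rw [rescale_gaussSeries, gaussSeries_mul, expSq_mul_gaussSeries]
      congr 1
      · simp
      · simp [hb w v]
        ring
    rw [h2, ← sum_pow_mul_mixCoeff _ _ _ _ hN, Finset.mul_sum] at h1
    calc _ = _ := Finset.sum_congr rfl fun x hx => ?_
      _ = _ := h1
      _ = _ := Finset.sum_congr rfl fun x _ => by ring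
    rw [Finset.HasAntidiagonal.mem_antidiagonal] at hx
    rw [map_smul, smul_eq_mul, hx]
    ring

/-- The star product multiplies the generating function by exp(Λ(v, w) x y), so Λ is simply added to
b in the mixed exponent. -/
theorem gaussFunctional_mulStar (hb : ∀ v w, b v w = b w v) (Λ : V →ₗ[ℂ] V →ₗ[ℂ] ℂ) (v w : V)
    {k l N : ℕ} (hN : k + l < N) :
    gaussFunctional b ρ (mulStar Λ (vpow v k ⊗ₜ vpow w l)) = k.factorial * l.factorial *
      mixCoeff (gaussSeries (ρ v) (b v v)) (gaussSeries (ρ w) (b w w)) (Λ v w + b v w) N k l := by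
  rw [mulStar_vpow Λ v w k l N (by omega), map_sum, ← sum_mixCoeff _ _ _ _ (by omega : k < N),
    Finset.mul_sum]
  refine Finset.sum_congr rfl fun t _ => ?_
  rw [map_smul, smul_eq_mul]
  split_ifs with h
  · rw [gaussFunctional_sym_mul b ρ hb v w (N := N) (by omega),
      ← Nat.factorial_mul_descFactorial h.1, ← Nat.factorial_mul_descFactorial h.2]
    push_cast
    ring
  · have : (k.descFactorial t : ℂ) * (l.descFactorial t : ℂ) = 0 := by
      rw [not_and_or] at h
      rcases h with h | h <;> simp [Nat.descFactorial_of_lt (not_le.mp h)]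
    rw [this]
    simp

/-- Entrywise powers of a positive semi-definite kernel are positive semi-definite. -/
theorem pow_posSemidef {ι : Type*} {K : ι → ι → ℂ} (hK : (Matrix.of K).PosSemidef) (s : ℕ) :
    (Matrix.of fun x y => K x y ^ s).PosSemidef := by
  induction s with
  | zero => simpa using rankOne_posSemidef fun _ : ι => (1 : ℂ)
  | succ s ih =>
    have e : (Matrix.of fun x y => K x y ^ (s + 1)) =
        Matrix.hadamard (Matrix.of fun x y => K x y ^ s) (Matrix.of K) := by
      ext x y
      simp [pow_succ]
    rw [e]
    exact ih.hadamard hK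

/-- Expanding the exponential of the mixed term in powers s writes the kernel as a non-negative
combination of rank-one kernels times entrywise powers of the positive form (Λ + b)(v̄, w). The
reality of ρ and b turns the Gaussian factor at v̄ into the conjugate of the one at v. -/
theorem gaussFunctional_nonneg (c : V →ₗ⋆[ℂ] V) (hc : ∀ v, c (c v) = v)
    (Λ : V →ₗ[ℂ] V →ₗ[ℂ] ℂ) (hΛ : ∀ v w, Λ v w = conj (Λ (c w) (c v)))
    (hb : ∀ v w, b v w = b w v) (hbc : ∀ v w, b v w = conj (b (c w) (c v)))
    (hρ : ∀ v, ρ (c v) = conj (ρ v)) (hpos : ∀ v, 0 ≤ Λ (c v) v + b (c v) v)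
    {X : TensorAlg V} (hX : X ∈ symTensors V) :
    0 ≤ gaussFunctional b ρ (mulStar Λ (tensorStar c X ⊗ₜ X)) := by
  obtain ⟨a, ha⟩ := exists_sum_vpow ⟨X, hX⟩
  dsimp only at ha
  subst ha
  set B : V →ₗ⋆[ℂ] V →ₗ[ℂ] ℂ := (Λ + b).comp c with hB
  have hsymm : ∀ v w, conj (B v w) = B w v := by
    intro v w
    simp only [hB, LinearMap.comp_apply, LinearMap.add_apply, map_add]
    rw [hΛ (c w) v, hbc (c w) v, hc]
  -- Larger than the sum of any two degrees in X, so one truncation serves all pairs.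
  set N := 2 * (a.support.sup Prod.snd) + 1 with hN
  set G : V → PowerSeries ℂ := fun v => gaussSeries (ρ v) (b v v) with hG
  have hGc : ∀ v n, PowerSeries.coeff n (G (c v)) = conj (PowerSeries.coeff n (G v)) := by
    intro v n
    simp only [hG]
    rw [map_conj_coeff_gaussSeries, hρ, hbc (c v), hc]
  have hGX : ∀ v k s, PowerSeries.coeff k (PowerSeries.X ^ s * G (c v)) =
      conj (PowerSeries.coeff k (PowerSeries.X ^ s * G v)) := by
    intro v k s
    rw [PowerSeries.coeff_X_pow_mul', PowerSeries.coeff_X_pow_mul', hGc]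
    split_ifs <;> simp
  set u : ℕ → V × ℕ → ℂ := fun s p =>
    p.2.factorial * PowerSeries.coeff p.2 (PowerSeries.X ^ s * G p.1) with hu
  have key : gaussFunctional b ρ (mulStar Λ (tensorStar c (a.sum fun p r => r • vpow p.1 p.2) ⊗ₜ
      (a.sum fun p r => r • vpow p.1 p.2))) = ∑ s ∈ Finset.range N, (s.factorial : ℂ)⁻¹ *
        a.sum fun p r => a.sum fun q t => star r *
          (Matrix.hadamard (Matrix.of fun x y => conj (u s x) * u s y)
            (Matrix.of fun x y : V × ℕ => B x.1 y.1 ^ s)) p q * t := by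
    simp only [Finsupp.sum, map_sum, map_smulₛₗ, tensorStar_vpow, TensorProduct.sum_tmul,
      TensorProduct.tmul_sum, TensorProduct.tmul_smul, ← TensorProduct.smul_tmul', RingHom.id_apply,
      smul_eq_mul, Finset.mul_sum]
    refine Finset.sum_comm.trans ?_
    rw [Finset.sum_comm' (s := Finset.range N) (t := fun _ => a.support)
      (s' := fun _ => Finset.range N) (t' := a.support) (by tauto)]
    refine Finset.sum_congr rfl fun p hp => ?_
    rw [Finset.sum_comm]
    refine Finset.sum_congr rfl fun q hq => ?_
    have h1 := Finset.le_sup (f := Prod.snd) hp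
    have h2 := Finset.le_sup (f := Prod.snd) hq
    rw [gaussFunctional_mulStar b ρ hb Λ (c p.1) q.1 (N := N) (by omega), mixCoeff]
    simp only [Finset.mul_sum]
    refine Finset.sum_congr rfl fun s _ => ?_
    change _ * (_ * (_ * (_ * (PowerSeries.coeff _ (_ * G (c p.1)) *
      PowerSeries.coeff _ (_ * G q.1))))) = _
    rw [hGX]
    simp only [Matrix.hadamard_apply, Matrix.of_apply, hu, map_mul, map_natCast, hB,
      LinearMap.comp_apply, LinearMap.add_apply, starRingEnd_apply]
    ring
  rw [key]
  refine Finset.sum_nonneg fun s _ => mul_nonneg (inv_nonneg.mpr (by exact_mod_cast Nat.zero_le _)) ?_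
  exact ((rankOne_posSemidef (u s)).hadamard (pow_posSemidef
    (form_posSemidef B hsymm hpos fun p : V × ℕ => p.1) s)).2 a

end Gauss

end

noncomputable section

/-! ### Continuity of Gaussian functionals -/

section Bound

variable {V : Type*} [AddCommGroup V] [Module ℂ V]

/-- A multilinear form whose rank one kernel is dominated by the tensor power of `B` is bounded. -/
theorem norm_lift_sq_le (B : V →ₗ⋆[ℂ] V →ₗ[ℂ] ℂ) {n : ℕ}
    (M : MultilinearMap ℂ (fun _ : Fin n => V) ℂ)
    (hM : (Matrix.of fun x y : Fin n → V => (∏ m, B (x m) (y m)) - conj (M x) * M y).PosSemidef)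
    (T : ⨂[ℂ]^n V) :
    n.factorial * ‖PiTensorProduct.lift M T‖ ^ 2 ≤ (powForm B n T T).re := by
  obtain ⟨a, rfl⟩ := exists_sum_tprod T
  have h := hM.2 a
  have e : (a.sum fun x r => a.sum fun y s => star r *
      (Matrix.of fun x y : Fin n → V => (∏ m, B (x m) (y m)) - conj (M x) * M y) x y * s) =
      (a.sum fun x r => a.sum fun y s => star r * (∏ m, B (x m) (y m)) * s) -
        ((‖PiTensorProduct.lift M (a.sum fun x r => r • PiTensorProduct.tprod ℂ x)‖ ^ 2 : ℝ) : ℂ) := by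
    rw [← Complex.normSq_eq_norm_sq, Complex.normSq_eq_conj_mul_self]
    simp only [Finsupp.sum, map_sum, map_smul, PiTensorProduct.lift.tprod, smul_eq_mul,
      Finset.sum_mul_sum, ← Finset.sum_sub_distrib, Matrix.of_apply, map_mul]
    refine Finset.sum_congr rfl fun x _ => Finset.sum_congr rfl fun y _ => ?_
    simp only [starRingEnd_apply]
    ring
  rw [e, sub_nonneg, Complex.le_def, Complex.ofReal_re] at h
  rw [powForm_sum_tprod, ← Complex.ofReal_natCast, Complex.re_ofReal_mul]
  exact mul_le_mul_of_nonneg_left h.1 (Nat.cast_nonneg _)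

/-- Both binomial coefficients, p + 2j over p and 2j over j, are bounded by powers of two. -/
theorem factorial_le_of_antidiagonal (p j : ℕ) :
    (p + 2 * j).factorial ≤ 2 ^ (p + 2 * j) * (p.factorial * (4 ^ j * j.factorial ^ 2)) := by
  have h1 : (2 * j).factorial ≤ 4 ^ j * j.factorial ^ 2 := by
    have h := Nat.choose_mul_factorial_mul_factorial (show j ≤ 2 * j by omega)
    rw [show 2 * j - j = j by omega, ← Nat.centralBinom_eq_two_mul_choose, mul_assoc, ← sq] at h
    rw [← h]
    exact Nat.mul_le_mul_right _ (by
      rw [Nat.centralBinom_eq_two_mul_choose]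
      exact (Nat.choose_le_two_pow _ _).trans (by rw [pow_mul]; norm_num))
  rw [← Nat.add_choose_mul_factorial_mul_factorial p (2 * j), mul_assoc]
  exact Nat.mul_le_mul (Nat.choose_le_two_pow _ _) (Nat.mul_le_mul_left _ h1)

/-- For p + 2j = n the square is n!² / (p!² 4^j j!²). One factor n! is cancelled against the
denominator up to 2^n; the other remains and is matched by the weight n! of the tensor norm. -/
theorem norm_gauss_coeff_sq_le {n : ℕ} {p : ℕ × ℕ}
    (hp : p ∈ Finset.HasAntidiagonal.antidiagonal n) :
    ‖(n.factorial : ℂ) * (p.1.factorial : ℂ)⁻¹ * PowerSeries.coeff p.2 (expSq 2⁻¹)‖ ^ 2 ≤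
      4 ^ n * n.factorial := by
  obtain ⟨p, q⟩ := p
  rw [Finset.HasAntidiagonal.mem_antidiagonal] at hp
  dsimp only at hp ⊢
  rw [coeff_expSq]
  split_ifs with h
  · obtain ⟨j, rfl⟩ := h
    subst hp
    rw [Nat.mul_div_cancel_left _ two_pos]
    have h1 : ((p + 2 * j).factorial : ℝ) ≤
        2 ^ (p + 2 * j) * (p.factorial * (4 ^ j * j.factorial ^ 2)) := by
      exact_mod_cast factorial_le_of_antidiagonal p j
    have h2 : (1 : ℝ) ≤ p.factorial := by exact_mod_cast Nat.one_le_iff_ne_zero.mpr p.factorial_ne_zero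
    have h3 : (0 : ℝ) < j.factorial := by exact_mod_cast j.factorial_pos
    have h4 : (2 : ℝ) ^ (p + 2 * j) ≤ 4 ^ (p + 2 * j) := by gcongr; norm_num
    simp only [norm_mul, norm_inv, norm_pow, Complex.norm_natCast, Complex.norm_ofNat]
    have e : (((p + 2 * j).factorial : ℝ) * (p.factorial : ℝ)⁻¹ *
        ((2 : ℝ)⁻¹ ^ j * (j.factorial : ℝ)⁻¹)) ^ 2 =
        ((p + 2 * j).factorial * (p + 2 * j).factorial) /
          (p.factorial ^ 2 * (4 ^ j * j.factorial ^ 2)) := by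
      have : (4 : ℝ) ^ j = 2 ^ j * 2 ^ j := by rw [← mul_pow]; norm_num
      rw [this, inv_pow]
      field_simp
    rw [e, div_le_iff₀ (by positivity)]
    calc ((p + 2 * j).factorial : ℝ) * (p + 2 * j).factorial
        ≤ (2 ^ (p + 2 * j) * (p.factorial * (4 ^ j * j.factorial ^ 2))) *
          (p + 2 * j).factorial := by gcongr
      _ ≤ (4 ^ (p + 2 * j) * (p.factorial ^ 2 * (4 ^ j * j.factorial ^ 2))) *
          (p + 2 * j).factorial := by
          have : (p.factorial : ℝ) ≤ p.factorial ^ 2 := by nlinarith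
          gcongr
      _ = _ := by ring
  · simp

/-- There are n + 1 ≤ 2^n summands, each bounded by 2^n times the norm. -/
theorem norm_gaussPow_le (b : V →ₗ[ℂ] V →ₗ[ℂ] ℂ) (ρ : V →ₗ[ℂ] ℂ)
    (B : V →ₗ⋆[ℂ] V →ₗ[ℂ] ℂ) (hsymm : ∀ v w, conj (B v w) = B w v)
    (hpos : ∀ v, 0 ≤ B v v) (hρ : ∀ v, conj (ρ v) * ρ v ≤ B v v)
    (hb : (Matrix.of fun x y : V × V => B x.1 y.1 * B x.2 y.2 -
      conj (b x.1 x.2) * b y.1 y.2).PosSemidef) (n : ℕ) (T : ⨂[ℂ]^n V) :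
    ‖gaussPow b ρ n T‖ ≤ 4 ^ n * √(powForm B n T T).re := by
  have hterm : ∀ p ∈ Finset.HasAntidiagonal.antidiagonal n,
      ‖(((n.factorial : ℂ) * (p.1.factorial : ℂ)⁻¹ * PowerSeries.coeff p.2 (expSq 2⁻¹)) •
        PiTensorProduct.lift (pairForm b ρ (p.2 / 2) n)) T‖ ≤ 2 ^ n * √(powForm B n T T).re := by
    intro p hp
    have h1 := norm_lift_sq_le B _ (pairForm_posSemidef b ρ B hsymm hpos hρ hb (p.2 / 2) n) T
    have h2 := norm_gauss_coeff_sq_le hp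
    have h0 : 0 ≤ (powForm B n T T).re := le_trans (by positivity) h1
    rw [LinearMap.smul_apply, smul_eq_mul, norm_mul]
    refine abs_le_of_sq_le_sq' ?_ (by positivity) |>.2
    rw [mul_pow, mul_pow, Real.sq_sqrt h0]
    calc _ ≤ (4 ^ n * n.factorial : ℝ) *
          ‖PiTensorProduct.lift (pairForm b ρ (p.2 / 2) n) T‖ ^ 2 := by gcongr
      _ ≤ 4 ^ n * (powForm B n T T).re := by rw [mul_assoc]; gcongr
      _ = _ := by rw [← pow_mul, mul_comm n, pow_mul]; norm_num
  rw [gaussPow, LinearMap.sum_apply]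
  refine (norm_sum_le_of_le _ hterm).trans ?_
  rw [Finset.sum_const, Finset.Nat.card_antidiagonal, nsmul_eq_mul, ← mul_assoc]
  refine mul_le_mul_of_nonneg_right ?_ (Real.sqrt_nonneg _)
  have h : ((n + 1 : ℕ) : ℝ) ≤ 2 ^ n := by exact_mod_cast Nat.succ_le_of_lt (Nat.lt_two_pow_self)
  calc ((n + 1 : ℕ) : ℝ) * 2 ^ n ≤ 2 ^ n * 2 ^ n := by gcongr
    _ = 4 ^ n := by rw [← mul_pow]; norm_num

theorem powForm_smul (B : V →ₗ⋆[ℂ] V →ₗ[ℂ] ℂ) (r : ℂ) (n : ℕ) (T : ⨂[ℂ]^n V) :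
    powForm (r • B) n T T = r ^ n * powForm B n T T := by
  obtain ⟨a, rfl⟩ := exists_sum_tprod T
  rw [powForm_sum_tprod, powForm_sum_tprod]
  simp only [LinearMap.smul_apply, smul_eq_mul, Finset.prod_mul_distrib, Finset.prod_const,
    Finset.card_univ, Fintype.card_fin, Finsupp.sum, Finset.mul_sum]
  refine Finset.sum_congr rfl fun x _ => Finset.sum_congr rfl fun y _ => ?_
  ring

theorem powForm_le_tensorForm (B : V →ₗ⋆[ℂ] V →ₗ[ℂ] ℂ) (hsymm : ∀ v w, conj (B v w) = B w v)
    (hpos : ∀ v, 0 ≤ B v v) (X : TensorAlg V) (n : ℕ) :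
    powForm B n (X n) (X n) ≤ tensorForm B X X := by
  classical
  rw [tensorForm_eq_sum]
  by_cases hn : n ∈ DFinsupp.support X
  · exact Finset.single_le_sum (f := fun n => powForm B n (X n) (X n))
      (fun k _ => powForm_nonneg B hsymm hpos k _) hn
  · rw [DFinsupp.notMem_support_iff] at hn
    rw [hn, map_zero]
    exact Finset.sum_nonneg fun k _ => powForm_nonneg B hsymm hpos k _

theorem gaussFunctional_eq_sum (b : V →ₗ[ℂ] V →ₗ[ℂ] ℂ) (X : TensorAlg V) :
    ∃ s : Finset ℕ, (∀ n, n ∉ s → X n = 0) ∧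
      ∀ ρ : V →ₗ[ℂ] ℂ, gaussFunctional b ρ X = ∑ n ∈ s, gaussPow b ρ n (X n) := by
  classical
  have h : X = ∑ n ∈ DFinsupp.support X, inDeg n (X n) := by
    conv_lhs => rw [← DirectSum.sum_support_of X]
    rfl
  refine ⟨DFinsupp.support X, fun n hn => DFinsupp.notMem_support_iff.mp hn, fun ρ => ?_⟩
  conv_lhs => rw [h]
  simp only [map_sum, gaussFunctional_inDeg]

variable [TopologicalSpace V]

/-- Scaling the form by 64 = 8² multiplies the seminorm in degree n by 8^n, which turns the growth
4^n into 2^(-n); the geometric series gives the constant 2. -/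
theorem norm_gaussFunctional_le (b : V →ₗ[ℂ] V →ₗ[ℂ] ℂ) (ρ : V →ₗ[ℂ] ℂ) (α : PosHermForm V)
    (hρ : ∀ v, conj (ρ v) * ρ v ≤ α.form v v)
    (hb : (Matrix.of fun x y : V × V => α.form x.1 y.1 * α.form x.2 y.2 -
      conj (b x.1 x.2) * b y.1 y.2).PosSemidef) (X : TensorAlg V) :
    ‖gaussFunctional b ρ X‖ ≤ 2 * tensorSeminorm (α.scale 64 (by norm_num)) X := by
  obtain ⟨s, -, hs⟩ := gaussFunctional_eq_sum b X
  set β := α.scale 64 (by norm_num) with hβ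
  have h1 : ∀ n ∈ s, ‖gaussPow b ρ n (X n)‖ ≤ (1 / 2) ^ n * tensorSeminorm β X := by
    intro n _
    refine (norm_gaussPow_le b ρ α.form α.conj_symm α.nonneg hρ hb n (X n)).trans ?_
    have h2 : (powForm β.form n (X n) (X n)).re = (8 ^ n) ^ 2 * (powForm α.form n (X n) (X n)).re := by
      have : β.form = (64 : ℂ) • α.form := by rw [hβ]; simp [PosHermForm.scale]
      rw [this, powForm_smul]
      have e : (64 : ℂ) ^ n = (((8 ^ n) ^ 2 : ℝ) : ℂ) := by
        rw [← pow_mul, mul_comm n, pow_mul]; norm_num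
      rw [e, Complex.re_ofReal_mul]
    have h3 : 8 ^ n * √(powForm α.form n (X n) (X n)).re ≤ tensorSeminorm β X := by
      rw [tensorSeminorm_apply]
      refine Real.le_sqrt_of_sq_le ?_
      rw [mul_pow, Real.sq_sqrt (Complex.nonneg_iff.mp
        (powForm_nonneg _ α.conj_symm α.nonneg n _)).1, ← h2]
      exact (Complex.le_def.mp (powForm_le_tensorForm _ β.conj_symm β.nonneg X n)).1
    calc (4 : ℝ) ^ n * √(powForm α.form n (X n) (X n)).re
        = (1 / 2) ^ n * (8 ^ n * √(powForm α.form n (X n) (X n)).re) := by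
          rw [← mul_assoc, ← mul_pow]; norm_num
      _ ≤ _ := by gcongr
  rw [hs]
  refine (norm_sum_le_of_le _ h1).trans ?_
  rw [← Finset.sum_mul]
  refine mul_le_mul_of_nonneg_right ?_ (apply_nonneg _ _)
  refine le_trans ?_ tsum_geometric_two.le
  exact summable_geometric_two.sum_le_tsum s fun n _ => by positivity

/-- The restriction of the Gaussian functional to symmetric tensors, as a continuous functional. -/
theorem exists_continuous_gaussFunctional (b : V →ₗ[ℂ] V →ₗ[ℂ] ℂ) (hb : IsHilbertSchmidt b)
    (ρ : V →L[ℂ] ℂ) :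
    ∃ ω : symTensors V →L[ℂ] ℂ, ∀ X : symTensors V, ω X = gaussFunctional b ρ.toLinearMap X := by
  obtain ⟨α, h0, h1⟩ := hb
  -- Adding the rank-one form makes γ dominate ρ, while γ ⊗ γ ≥ α ⊗ α still dominates b.
  set γ := α.add (PosHermForm.ofFunctional ρ) with hγ
  have hform : ∀ v w, γ.form v w = α.form v w + conj (ρ v) * ρ w := fun _ _ => rfl
  have hρ : ∀ v, conj (ρ.toLinearMap v) * ρ.toLinearMap v ≤ γ.form v v := fun v => by
    rw [hform]; exact le_add_of_nonneg_left (α.nonneg v)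
  have hle : ∀ v, α.form v v ≤ γ.form v v := fun v => by
    rw [hform]; exact le_add_of_nonneg_right (star_mul_self_nonneg (ρ v))
  have hα := hilbertSchmidt_posSemidef b α.form α.conj_symm α.nonneg
    (fun v w h => h0 v w (by simpa only [PosHermForm.seminorm_eq_zero] using h)) h1
  have hb' : (Matrix.of fun x y : V × V => γ.form x.1 y.1 * γ.form x.2 y.2 -
      conj (b x.1 x.2) * b y.1 y.2).PosSemidef := by
    have h2 := (prodForm_sub_posSemidef α.form γ.form α.conj_symm α.nonneg γ.conj_symm hle
      (k := 2) Finset.univ).submatrix fun x : V × V => ![x.1, x.2]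
    convert hα.add h2 using 1
    ext x y
    simp [Fin.prod_univ_two]
  have hcont : Continuous (gaussFunctional b ρ.toLinearMap) := by
    refine WithSeminorms.continuous_normedSpace_rng (E := TensorAlg V) ℂ
      (tensorAlg_withSeminorms (V := V)) (gaussFunctional b ρ.toLinearMap)
      ⟨{γ.scale 64 (by norm_num)}, 2, fun X => ?_⟩
    rw [Finset.sup_singleton]
    exact norm_gaussFunctional_le b ρ.toLinearMap γ hρ hb' X
  exact ⟨⟨gaussFunctional b ρ.toLinearMap ∘ₗ (symTensors V).subtype,
    hcont.comp continuous_subtype_val⟩, fun X => rfl⟩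

end Bound

end

noncomputable section

/-! ### Gaussian functionals separate points -/

section Separation

variable {V : Type*} [AddCommGroup V] [Module ℂ V]

/-- The linear functional `f_1 ⊗ ⋯ ⊗ f_n`. -/
def prodFunctional {n : ℕ} (f : Fin n → V →ₗ[ℂ] ℂ) : ⨂[ℂ]^n V →ₗ[ℂ] ℂ :=
  PiTensorProduct.lift ((MultilinearMap.mkPiAlgebra ℂ (Fin n) ℂ).compLinearMap f)

theorem prodFunctional_tprod {n : ℕ} (f : Fin n → V →ₗ[ℂ] ℂ) (x : Fin n → V) :
    prodFunctional f (PiTensorProduct.tprod ℂ x) = ∏ m, f m (x m) := by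
  simp [prodFunctional]

theorem prodFunctional_sum {n : ℕ} (f : Fin n → V →ₗ[ℂ] ℂ) (a : (Fin n → V) →₀ ℂ) :
    prodFunctional f (a.sum fun x r => r • PiTensorProduct.tprod ℂ x) =
      a.sum fun x r => r * ∏ m, f m (x m) := by
  simp [Finsupp.sum, prodFunctional_tprod]

theorem pairForm_smul (b : V →ₗ[ℂ] V →ₗ[ℂ] ℂ) (ρ : V →ₗ[ℂ] ℂ) (s : ℂ) (p j : ℕ) :
    pairForm b (s • ρ) j (p + 2 * j) = s ^ p • pairForm b ρ j (p + 2 * j) := by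
  induction j with
  | zero => ext x; simp [pairForm_zero, Finset.prod_mul_distrib]
  | succ j ih =>
    ext x
    change pairForm b (s • ρ) (j + 1) (p + 2 * j + 2) x =
      s ^ p * pairForm b ρ (j + 1) (p + 2 * j + 2) x
    rw [pairForm_succ, pairForm_succ, ih, smul_apply, smul_eq_mul]
    ring

theorem gaussPow_smul (b : V →ₗ[ℂ] V →ₗ[ℂ] ℂ) (ρ : V →ₗ[ℂ] ℂ) (s : ℂ) (n : ℕ) (T : ⨂[ℂ]^n V) :
    gaussPow b (s • ρ) n T = ∑ p ∈ Finset.HasAntidiagonal.antidiagonal n, s ^ p.1 *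
      (((n.factorial : ℂ) * (p.1.factorial : ℂ)⁻¹ * PowerSeries.coeff p.2 (expSq 2⁻¹)) *
        PiTensorProduct.lift (pairForm b ρ (p.2 / 2) n) T) := by
  rw [gaussPow, LinearMap.sum_apply]
  refine Finset.sum_congr rfl fun p hp => ?_
  rw [Finset.HasAntidiagonal.mem_antidiagonal] at hp
  rw [LinearMap.smul_apply, smul_eq_mul, coeff_expSq]
  split_ifs with h
  · obtain ⟨j, hj⟩ := h
    obtain ⟨p, q⟩ := p
    dsimp only at hj hp ⊢
    subst hj
    subst hp
    rw [Nat.mul_div_cancel_left _ two_pos, pairForm_smul, map_smul, LinearMap.smul_apply,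
      smul_eq_mul]
    ring
  · simp

theorem polynomial_eq_zero_of_real {Q : Polynomial ℂ} (h : ∀ s : ℝ, Q.eval (s : ℂ) = 0) :
    Q = 0 := by
  refine Polynomial.eq_zero_of_infinite_isRoot Q ?_
  refine (Set.infinite_range_of_injective Complex.ofReal_injective).mono ?_
  rintro _ ⟨s, rfl⟩
  exact h s

/-- The leading component of a tensor on which the Gaussian functionals with means `s • ρ` vanish is
annihilated by `ρ ⊗ ⋯ ⊗ ρ`. -/
theorem prodFunctional_eq_zero_of_gauss (b : V →ₗ[ℂ] V →ₗ[ℂ] ℂ) (ρ : V →ₗ[ℂ] ℂ)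
    {X : TensorAlg V} (h : ∀ s : ℝ, gaussFunctional b ((s : ℂ) • ρ) X = 0) {N : ℕ}
    (hN : ∀ n, N < n → X n = 0) : prodFunctional (fun _ => ρ) (X N) = 0 := by
  obtain ⟨S, hS, hsum⟩ := gaussFunctional_eq_sum b X
  by_cases hNS : N ∈ S
  swap
  · rw [hS N hNS, map_zero]
  set d : ℕ → ℕ × ℕ → ℂ := fun n p =>
    ((n.factorial : ℂ) * (p.1.factorial : ℂ)⁻¹ * PowerSeries.coeff p.2 (expSq 2⁻¹)) *
        PiTensorProduct.lift (pairForm b ρ (p.2 / 2) n) (X n) with hd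
  have hQ : ∑ n ∈ S, ∑ p ∈ Finset.HasAntidiagonal.antidiagonal n,
      Polynomial.monomial p.1 (d n p) = 0 := by
    refine polynomial_eq_zero_of_real fun s => ?_
    rw [← h s, hsum]
    simp only [Polynomial.eval_finsetSum, Polynomial.eval_monomial, gaussPow_smul]
    exact Finset.sum_congr rfl fun n _ => Finset.sum_congr rfl fun p _ => mul_comm _ _
  have hc := congrArg (fun Q => Polynomial.coeff Q N) hQ
  simp only [Polynomial.finsetSum_coeff, Polynomial.coeff_monomial, Polynomial.coeff_zero] at hc
  -- The power s^N arises only from n = N and p = (N, 0): smaller n give smaller exponents, and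
  -- components of larger degree vanish.
  rw [Finset.sum_eq_single_of_mem N hNS, Finset.sum_eq_single_of_mem (N, 0) (by simp)] at hc
  · have hfac : (N.factorial : ℂ) ≠ 0 := by exact_mod_cast N.factorial_ne_zero
    have hdN : d N (N, 0) = prodFunctional (fun _ => ρ) (X N) := by
      simp only [hd, coeff_expSq]
      simp [hfac]
      rfl
    simpa [hdN] using hc
  · intro p hp hne
    rw [if_neg]
    intro e
    rw [Finset.HasAntidiagonal.mem_antidiagonal] at hp
    exact hne (Prod.ext e (by simp; omega))
  · intro n _ hne
    refine Finset.sum_eq_zero fun p hp => ?_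
    rw [Finset.HasAntidiagonal.mem_antidiagonal] at hp
    split_ifs with e
    · have : X n = 0 := hN n (by omega)
      simp [hd, this]
    · rfl

/-- The value is polynomial in the parameter, so vanishing at real parameters extends to complex
ones. -/
theorem prodFunctional_add_smul {n : ℕ} (ρ σ : V →ₗ[ℂ] ℂ) (T : ⨂[ℂ]^n V)
    (h : ∀ s : ℝ, prodFunctional (fun _ => ρ + (s : ℂ) • σ) T = 0) (z : ℂ) :
    prodFunctional (fun _ => ρ + z • σ) T = 0 := by
  obtain ⟨a, rfl⟩ := exists_sum_tprod T
  simp only [prodFunctional_sum] at h ⊢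
  set Q : Polynomial ℂ := a.sum fun x r => Polynomial.C r *
    ∏ m, (Polynomial.C (ρ (x m)) + Polynomial.X * Polynomial.C (σ (x m))) with hQ
  have he : ∀ z : ℂ, Q.eval z = a.sum fun x r => r * ∏ m, (ρ + z • σ) (x m) := by
    intro z
    simp [hQ, Finsupp.sum, Polynomial.eval_finsetSum, Polynomial.eval_prod, mul_comm z]
  have h0 : Q = 0 := polynomial_eq_zero_of_real fun s => by rw [he, h]
  rw [← he, h0, Polynomial.eval_zero]

/-- Permuting the vectors amounts to permuting the functionals inversely, so polarisation applies to
the functionals. -/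
theorem prodFunctional_powSym {n : ℕ} (f : Fin n → V →ₗ[ℂ] ℂ) (T : ⨂[ℂ]^n V) :
    prodFunctional f (powSym n T) = (n.factorial : ℂ)⁻¹ * ∑ u : Finset (Fin n),
      (-1 : ℤ) ^ u.card • prodFunctional (fun _ => ∑ i ∈ uᶜ, f i) T := by
  obtain ⟨a, rfl⟩ := exists_sum_tprod T
  have key : ∀ x : Fin n → V, prodFunctional f (powSym n (PiTensorProduct.tprod ℂ x)) =
      (n.factorial : ℂ)⁻¹ * ∑ u : Finset (Fin n),
        (-1 : ℤ) ^ u.card • ∏ m, (∑ i ∈ uᶜ, f i) (x m) := by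
    intro x
    have h := sum_neg_one_pow_multilinear ((MultilinearMap.mkPiAlgebra ℂ (Fin n) ℂ).compLinearMap
      fun m => LinearMap.applyₗ (x m)) f
    simp only [MultilinearMap.compLinearMap_apply, MultilinearMap.mkPiAlgebra_apply,
      LinearMap.applyₗ_apply_apply] at h
    rw [h, powSym_tprod, map_smul, map_sum, smul_eq_mul]
    congr 1
    simp only [prodFunctional_tprod]
    refine Fintype.sum_equiv (Equiv.inv _) _ _ fun σ => ?_
    rw [← Equiv.prod_comp σ fun m => f ((Equiv.inv _ σ) m) (x m)]
    simp
  simp only [prodFunctional_sum]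
  simp only [Finsupp.sum, map_sum, map_smul, smul_eq_mul, key]
  simp only [Finset.mul_sum, Finset.smul_sum]
  rw [Finset.sum_comm]
  refine Finset.sum_congr rfl fun u _ => Finset.sum_congr rfl fun x _ => ?_
  simp only [zsmul_eq_mul]
  ring

variable [TopologicalSpace V]

theorem separatingDual_of_locallyConvex [IsTopologicalAddGroup V] [ContinuousSMul ℂ V]
    [LocallyConvexSpace ℝ V] [T2Space V] : SeparatingDual ℂ V :=
  ⟨fun x hx => by
    obtain ⟨f, hf⟩ := RCLike.geometric_hahn_banach_point_point (𝕜 := ℂ) hx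
    exact ⟨f, fun h => by simp [h] at hf⟩⟩

/-- A tensor on which all products of continuous functionals vanish is zero. -/
theorem eq_zero_of_prodFunctional [SeparatingDual ℂ V] {n : ℕ} {T : ⨂[ℂ]^n V}
    (h : ∀ f : Fin n → V →L[ℂ] ℂ, prodFunctional (fun m => (f m).toLinearMap) T = 0) : T = 0 := by
  classical
  obtain ⟨a, rfl⟩ := exists_sum_tprod T
  set s : Finset V := a.support.biUnion fun x => Finset.univ.image x with hs
  set W := Submodule.span ℂ (s : Set V) with hW
  have : FiniteDimensional ℂ W := FiniteDimensional.span_finset ℂ s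
  let e := Module.finBasis ℂ W
  -- All vectors in T span a finite-dimensional W, and the coordinate functionals of W extend
  -- continuously to V. The products of these extensions are the coordinates of T.
  have hsurj := (SeparatingDual.dualMap_surjective_iff (R := ℂ) (f := W.subtype)).mpr
    W.injective_subtype
  choose F hF using fun i => hsurj (e.coord i)
  have hFW : ∀ i (w : W), F i w = e.coord i w := fun i w => LinearMap.congr_fun (hF i) w
  have hmem : ∀ x ∈ a.support, ∀ m, x m = ∑ i, F i (x m) • (e i : V) := by
    intro x hx m
    have hxm : x m ∈ W := Submodule.subset_span (by
      simp only [hs, Finset.coe_biUnion, Set.mem_iUnion]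
      exact ⟨x, hx, by simp⟩)
    have h1 := e.sum_repr ⟨x m, hxm⟩
    have h2 := congrArg W.subtype h1
    rw [map_sum] at h2
    refine h2.symm.trans (Finset.sum_congr rfl fun i _ => ?_)
    rw [map_smul, hFW i ⟨x m, hxm⟩]
    rfl
  have hexp : ∀ x ∈ a.support, PiTensorProduct.tprod ℂ x = ∑ I : Fin n → Fin (Module.finrank ℂ W),
      (∏ m, F (I m) (x m)) • PiTensorProduct.tprod ℂ fun m => (e (I m) : V) := by
    intro x hx
    conv_lhs => rw [show x = fun m => ∑ i, F i (x m) • (e i : V) from funext (hmem x hx)]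
    rw [MultilinearMap.map_sum]
    exact Finset.sum_congr rfl fun I _ => MultilinearMap.map_smul_univ _ _ _
  have h1 : (a.sum fun x r => r • PiTensorProduct.tprod ℂ x) =
      ∑ I : Fin n → Fin (Module.finrank ℂ W),
        prodFunctional (fun m => (F (I m)).toLinearMap)
          (a.sum fun x r => r • PiTensorProduct.tprod ℂ x) •
            PiTensorProduct.tprod ℂ fun m => (e (I m) : V) := by
    simp only [prodFunctional_sum]
    simp only [Finsupp.sum, Finset.sum_smul]
    rw [Finset.sum_comm]
    refine Finset.sum_congr rfl fun x hx => ?_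
    rw [hexp x hx, Finset.smul_sum]
    exact Finset.sum_congr rfl fun I _ => smul_smul _ _ _
  rw [h1]
  exact Finset.sum_eq_zero fun I _ => by rw [h fun m => F (I m), zero_smul]

/-- The Hermitian conjugate of a continuous linear functional. -/
def conjFunctional (c : V →L⋆[ℂ] V) (ρ : V →L[ℂ] ℂ) : V →L[ℂ] ℂ where
  toFun v := conj (ρ (c v))
  map_add' := by simp
  map_smul' := by simp
  cont := Complex.continuous_conj.comp (ρ.continuous.comp c.continuous)

theorem conjFunctional_apply (c : V →L⋆[ℂ] V) (ρ : V →L[ℂ] ℂ) (v : V) :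
    conjFunctional c ρ v = conj (ρ (c v)) := rfl

/-- The leading component is annihilated by ρ ⊗ ⋯ ⊗ ρ for Hermitian ρ, then for all continuous ρ by
complexification, then by all products of functionals by polarisation; hence it is zero. -/
theorem eq_zero_of_gaussFunctional [SeparatingDual ℂ V] (c : V →L⋆[ℂ] V) (hc : ∀ v, c (c v) = v)
    (b : V →ₗ[ℂ] V →ₗ[ℂ] ℂ) {X : TensorAlg V} (hX : X ∈ symTensors V)
    (h : ∀ ρ : V →L[ℂ] ℂ, (∀ v, ρ (c v) = conj (ρ v)) →
      gaussFunctional b ρ.toLinearMap X = 0) : X = 0 := by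
  classical
  by_contra hne
  have hsupp : (DFinsupp.support X).Nonempty := by
    rw [Finset.nonempty_iff_ne_empty]
    exact fun h0 => hne (DFinsupp.support_eq_empty.mp h0)
  set N := (DFinsupp.support X).max' hsupp with hN
  have hXN : X N ≠ 0 := DFinsupp.mem_support_iff.mp (Finset.max'_mem _ hsupp)
  have hlt : ∀ n, N < n → X n = 0 := fun n hn => by
    by_contra h0
    exact absurd (Finset.le_max' _ n (DFinsupp.mem_support_iff.mpr h0)) (not_le.mpr hn)
  have hherm : ∀ ρ : V →L[ℂ] ℂ, (∀ v, ρ (c v) = conj (ρ v)) →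
      prodFunctional (fun _ => ρ.toLinearMap) (X N) = 0 := by
    intro ρ hρ
    refine prodFunctional_eq_zero_of_gauss b ρ.toLinearMap (fun s => ?_) hlt
    exact h ((s : ℂ) • ρ) fun v => by simp [hρ]
  have hall : ∀ ρ : V →L[ℂ] ℂ, prodFunctional (fun _ => ρ.toLinearMap) (X N) = 0 := by
    intro ρ
    -- Real and imaginary parts for the involution: ρ₁ + s ρ₂ is Hermitian for real s, and ρ is its
    -- value at s = i.
    set ρ₁ : V →L[ℂ] ℂ := (2 : ℂ)⁻¹ • (ρ + conjFunctional c ρ) with h₁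
    set ρ₂ : V →L[ℂ] ℂ := (2 * Complex.I : ℂ)⁻¹ • (ρ - conjFunctional c ρ) with h₂
    have e₁ : ∀ v, ρ₁ (c v) = conj (ρ₁ v) := by
      intro v
      simp [h₁, conjFunctional_apply, hc, add_comm, Complex.conj_ofNat]
    have e₂ : ∀ v, ρ₂ (c v) = conj (ρ₂ v) := by
      intro v
      simp [h₂, conjFunctional_apply, hc, Complex.conj_ofNat]
      ring
    have e : ρ.toLinearMap = ρ₁.toLinearMap + Complex.I • ρ₂.toLinearMap := by
      ext v
      simp [h₁, h₂]
      ring_nf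
      simp
      ring
    rw [e]
    refine prodFunctional_add_smul _ _ _ (fun s => ?_) _
    exact hherm (ρ₁ + (s : ℂ) • ρ₂) fun v => by simp [e₁, e₂]
  refine hXN (eq_zero_of_prodFunctional fun f => ?_)
  have hsym : powSym N (X N) = X N := by
    have := congrArg (fun Y : TensorAlg V => Y N) (sym_of_mem hX)
    exact this
  rw [← hsym, prodFunctional_powSym, Finset.sum_eq_zero, mul_zero]
  intro u _
  have := hall (∑ i ∈ uᶜ, f i)
  rw [show (∑ i ∈ uᶜ, f i : V →L[ℂ] ℂ).toLinearMap = ∑ i ∈ uᶜ, (f i).toLinearMap by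
    ext; simp] at this
  rw [this, smul_zero]

end Separation

end

end HilbertStar

/-! ### Existence criterion and point separation -/

theorem theorem3p25 {V : Type*} [AddCommGroup V] [Module ℂ V] [TopologicalSpace V]
    [IsTopologicalAddGroup V] [ContinuousSMul ℂ V] [LocallyConvexSpace ℝ V] [T2Space V]
    [Nontrivial V] (hV : HilbertStar.IsHilbertisable V)
    (c : V →L⋆[ℂ] V) (hc : ∀ v, c (c v) = v)
    (Λ : V →ₗ[ℂ] V →ₗ[ℂ] ℂ) (hΛcont : Continuous fun p : V × V => Λ p.1 p.2)
    (hΛ : HilbertStar.IsHermitian c Λ) :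
    ((∃ ω : HilbertStar.symTensors V →L[ℂ] ℂ, ω ≠ 0 ∧ HilbertStar.IsPositive c Λ ω) ↔
      ∃ b : V →ₗ[ℂ] V →ₗ[ℂ] ℂ, (∀ v w, b v w = b w v) ∧ HilbertStar.IsHermitian c b ∧
        HilbertStar.IsHilbertSchmidt b ∧ ∀ v, 0 ≤ Λ (c v) v + b (c v) v) ∧
    ((∃ ω : HilbertStar.symTensors V →L[ℂ] ℂ, ω ≠ 0 ∧ HilbertStar.IsPositive c Λ ω) →
      ∀ X : HilbertStar.symTensors V,
        (∀ ω : HilbertStar.symTensors V →L[ℂ] ℂ, HilbertStar.IsPositive c Λ ω → ω X = 0) →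
          X = 0) := by
  have hgauss : ∀ b : V →ₗ[ℂ] V →ₗ[ℂ] ℂ, (∀ v w, b v w = b w v) → HilbertStar.IsHermitian c b →
      HilbertStar.IsHilbertSchmidt b → (∀ v, 0 ≤ Λ (c v) v + b (c v) v) →
      ∀ ρ : V →L[ℂ] ℂ, (∀ v, ρ (c v) = conj (ρ v)) →
      ∃ ω : HilbertStar.symTensors V →L[ℂ] ℂ, HilbertStar.IsPositive c Λ ω ∧
        ∀ X : HilbertStar.symTensors V,
          ω X = HilbertStar.gaussFunctional b ρ.toLinearMap X := by
    intro b hb hbc hHS hpos ρ hρ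
    obtain ⟨ω, hω⟩ := HilbertStar.exists_continuous_gaussFunctional b hHS ρ
    refine ⟨ω, fun X => ?_, hω⟩
    rw [hω]
    exact HilbertStar.gaussFunctional_nonneg b ρ.toLinearMap c.toLinearMap hc Λ hΛ hb hbc hρ hpos X.2
  have hfwd : (∃ ω : HilbertStar.symTensors V →L[ℂ] ℂ, ω ≠ 0 ∧ HilbertStar.IsPositive c Λ ω) →
      ∃ b : V →ₗ[ℂ] V →ₗ[ℂ] ℂ, (∀ v w, b v w = b w v) ∧ HilbertStar.IsHermitian c b ∧
        HilbertStar.IsHilbertSchmidt b ∧ ∀ v, 0 ≤ Λ (c v) v + b (c v) v := by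
    rintro ⟨ω, hω, hpos⟩
    exact HilbertStar.exists_bilin_of_isPositive hc hpos hω
  refine ⟨⟨hfwd, ?_⟩, fun h X hX => ?_⟩
  · rintro ⟨b, hb, hbc, hHS, hpos⟩
    -- The centred Gaussian suffices; it is non-zero because it sends 1 to 1.
    obtain ⟨ω, hω, hval⟩ := hgauss b hb hbc hHS hpos 0 (by simp)
    refine ⟨ω, fun h0 => ?_, hω⟩
    have h1 := hval ⟨1, HilbertStar.one_mem_symTensors⟩
    have h2 := HilbertStar.gaussFunctional_vpow b 0 (0 : V) 0
    rw [HilbertStar.vpow_zero] at h2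
    have h3 : HilbertStar.gaussFunctional b 0 (1 : HilbertStar.TensorAlg V) = 1 := by
      rw [h2]
      simp [HilbertStar.gaussSeries, HilbertStar.expSq]
    rw [h0] at h1
    exact zero_ne_one (h1.trans h3)
  · obtain ⟨b, hb, hbc, hHS, hpos⟩ := hfwd h
    have := HilbertStar.separatingDual_of_locallyConvex (V := V)
    refine Subtype.ext (HilbertStar.eq_zero_of_gaussFunctional c hc b X.2 fun ρ hρ => ?_)
    obtain ⟨ω, hω, hval⟩ := hgauss b hb hbc hHS hpos ρ hρ
    rw [← hval, hX ω hω]
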